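/- **Sectional curvature moments of products.** Let $[x]_s := x(x-1)\cdots(x-s+1)$ denote the falling factorial. For a euclidean vector space $V$ of dimension $m$ with scalar product $g$ and an algebraic curvature tensor $R:V\times V\times V\to V$, $(X,Y,Z)\mapsto R_{X,Y}Z$, put for $k\in\mathbb N_0$ $$\Psi_k(R)\;:=\;\frac{(-\Delta_g)^k}{[\,m+2k-2\,]_{2k}}\bigg|_0\Big(X\longmapsto \exp\Big(\sum_{r>0}\tfrac1{2r}\,\mathrm{tr}_V\big(R_{\,\cdot\,,X}X\big)^r\Big)\Big),$$ where $\Delta_g$ is the positive Laplace operator of $(V,g)$, so that $-\Delta_g$ is the sum of the second partial derivatives in orthonormal coordinates. Let $M$ and $N$ be smooth Riemannian manifolds (without boundary) of dimensions $m,n\ge 2$, and let $M\times N$ carry the product metric. Write $R^M_p$ for the curvature tensor at $p$ of the Levi-Civita connection of $M$, $R_{X,Y}=[\nabla_X,\nabla_Y]-\nabla_{[X,Y]}$, considered as a curvature tensor on the euclidean vector space $T_pM$, and similarly for $N$ and $M\times N$. Then for all $(p,q)\in M\times N$: 1. $R^{M\times N}_{(p,q)}=R^M_p\oplus R^N_q$,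 that is $$(R^{M\times N}_{(p,q)})_{X,Y}Z=(R^M_p)_{\mathrm{pr}_MX,\mathrm{pr}_MY}\,\mathrm{pr}_MZ\;\oplus\;(R^N_q)_{\mathrm{pr}_NX,\mathrm{pr}_NY}\,\mathrm{pr}_NZ$$ for all $X,Y,Z\in T_{(p,q)}(M\times N)=T_pM\oplus T_qN$. 2. For all $k\in\mathbb N_0$ $$\Psi_k\big(R^{M\times N}_{(p,q)}\big)=\sum_{r=0}^k\binom kr\,\frac{[\,m+2r-2\,]_{2r}\,[\,n+2(k-r)-2\,]_{2(k-r)}}{[\,m+n+2k-2\,]_{2k}}\;\Psi_r(R^M_p)\,\Psi_{k-r}(R^N_q).$$ 3. Suppose in addition that $M$ and $N$ are compact, and let $E_M[k]:=\frac1{\mathrm{Vol}\,M}\int_M\Psi_k(R^M_p)\,\mathrm{vol}_g(p)$ denote the $k$-th integrated moment of $M$, similarly $E_N[k]$ and $E_{M\times N}[k]$. These integrals exist, and for all $k\in\mathbb N_0$ $$E_{M\times N}[k]=\sum_{r=0}^k\binom kr\,\frac{[\,m+2r-2\,]_{2r}\,[\,n+2(k-r)-2\,]_{2(k-r)}}{[\,m+n+2k-2\,]_{2k}}\;E_M[r]\,E_N[k-r].$$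 -/

import Mathlib

set_option maxSynthPendingDepth 3

open Bundle MeasureTheory Manifold Set
open scoped ContDiff

noncomputable section

/-- The falling factorial polynomial `[x]_s = x (x - 1) ⋯ (x - s + 1)`. -/
def fallingFactorial (x : ℝ) (s : ℕ) : ℝ := ∏ i ∈ Finset.range s, (x - i)

/-! ### The pointwise moments `Ψ_k` on a euclidean vector space -/

/-- The Jacobi operator `A ↦ R_{A, X} X` of a trilinear map `(X, Y, Z) ↦ R_{X, Y} Z`. -/
def jacobiOperator {V : Type*} [AddCommGroup V] [Module ℝ V]
    (R : V →ₗ[ℝ] V →ₗ[ℝ] V →ₗ[ℝ] V) (X : V) : V →ₗ[ℝ] V where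
  toFun A := R A X X
  map_add' A B := by simp
  map_smul' c A := by simp

/-- The generating function `X ↦ exp (∑_{r > 0} (1 / 2r) tr (R_{·, X} X)^r)`; the sum is indexed by
`r - 1`. The series converges for all `X` in a neighbourhood of the origin, and only the germ of
this function at the origin is ever used. -/
def momentGeneratingFunction {V : Type*} [AddCommGroup V] [Module ℝ V]
    (R : V →ₗ[ℝ] V →ₗ[ℝ] V →ₗ[ℝ] V) (X : V) : ℝ :=
  Real.exp (∑' r : ℕ, 1 / (2 * ((r : ℝ) + 1)) *
    LinearMap.trace ℝ V (jacobiOperator R X ^ (r + 1)))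

open scoped Laplacian in
/-- `Ψ_k(R) = (-Δ_g)^k|_0 (exp (∑_{r > 0} (1 / 2r) tr (R_{·, X} X)^r)) / [m + 2k - 2]_{2k}` on a
euclidean vector space `V` of dimension `m`. Here `Δ_g` is the positive Laplace operator, so that
`-Δ_g` is the trace of the Hessian, which is Mathlib's Laplacian. -/
def sectionalMoment {V : Type*} [NormedAddCommGroup V] [InnerProductSpace ℝ V]
    [FiniteDimensional ℝ V] (k : ℕ) (R : V →ₗ[ℝ] V →ₗ[ℝ] V →ₗ[ℝ] V) : ℝ :=
  ((fun f : V → ℝ => Δ f)^[k] (momentGeneratingFunction R)) 0 /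
    fallingFactorial ((Module.finrank ℝ V : ℝ) + 2 * k - 2) (2 * k)

/-! ### The Levi-Civita connection and its curvature in coordinates -/

section Coordinates

variable {E : Type*} [NormedAddCommGroup E] [NormedSpace ℝ E]

/-- The trilinear form `K(u, v, w) = (D_u g(v, w) + D_v g(u, w) - D_w g(u, v)) / 2`, where
`D u v w` is the derivative of `g(v, w)` in direction `u`. -/
def koszulForm (D : E →L[ℝ] E →L[ℝ] E →L[ℝ] ℝ) : E →L[ℝ] E →L[ℝ] E →L[ℝ] ℝ :=
  (1 / 2 : ℝ) • (D + D.flip -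
    (ContinuousLinearMap.flipₗᵢ ℝ E E ℝ : (E →L[ℝ] E →L[ℝ] ℝ) →L[ℝ] (E →L[ℝ] E →L[ℝ] ℝ)) ∘L D.flip)

/-- The Levi-Civita connection of a metric `G` on an open subset of a vector space: `Γ_y(u, v)` is
the covariant derivative at `y` of the constant vector field `v` in direction `u`. It is determined
by the Koszul formula `G_y(Γ_y(u, v), w) = K_y(u, v, w)`, the Lie brackets of constant vector fields
being zero. Covariant derivatives of arbitrary vector fields are
`(∇_X Y)(y) = D_{X(y)} Y + Γ_y(X(y), Y(y))`. -/
def christoffel (G : E → E →L[ℝ] E →L[ℝ] ℝ) (y : E) : E →L[ℝ] E →L[ℝ] E :=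
  (ContinuousLinearMap.compL ℝ E (E →L[ℝ] ℝ) E (G y).inverse) ∘L koszulForm (fderiv ℝ G y)

/-- The curvature tensor `R_{u, v} w = ∇_u ∇_v w - ∇_v ∇_u w - ∇_{[u, v]} w` of the Levi-Civita
connection of a metric `G` on an open subset of a vector space. For constant vector fields this is
`(D_u Γ)(v, w) - (D_v Γ)(u, w) + Γ(u, Γ(v, w)) - Γ(v, Γ(u, w))`. -/
def coordCurvature (G : E → E →L[ℝ] E →L[ℝ] ℝ) (y : E) : E →ₗ[ℝ] E →ₗ[ℝ] E →ₗ[ℝ] E :=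
  LinearMap.mk₂ ℝ
    (fun u v => ((fderiv ℝ (christoffel G) y u v - fderiv ℝ (christoffel G) y v u
      + christoffel G y u ∘L christoffel G y v - christoffel G y v ∘L christoffel G y u :
      E →L[ℝ] E) : E →ₗ[ℝ] E))
    (fun _ _ _ => by ext; simp; abel) (fun _ _ _ => by ext; simp [smul_sub])
    (fun _ _ _ => by ext; simp; abel) (fun _ _ _ => by ext; simp [smul_sub])

end Coordinates

/-! ### Riemannian manifolds -/

/-- Smooth Riemannian metrics on `M`. -/
abbrev SmoothRiemannianMetric {E : Type*} [NormedAddCommGroup E] [NormedSpace ℝ E]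
    {H : Type*} [TopologicalSpace H] (I : ModelWithCorners ℝ E H)
    (M : Type*) [TopologicalSpace M] [ChartedSpace H M] [IsManifold I ∞ M] :=
  ContMDiffRiemannianMetric I ∞ E (fun x : M => TangentSpace I x)

section Manifold

variable {E : Type*} [NormedAddCommGroup E] [NormedSpace ℝ E]
  {H : Type*} [TopologicalSpace H] {I : ModelWithCorners ℝ E H}
  {M : Type*} [TopologicalSpace M] [ChartedSpace H M] [IsManifold I ∞ M]

/-- The coordinate expression at `y : E` of the metric in the preferred chart `φ` at `x`, that is
`(u, v) ↦ g(dφ⁻¹ u, dφ⁻¹ v)`. -/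
def chartMetric (g : SmoothRiemannianMetric I M) (x : M) (y : E) : E →L[ℝ] E →L[ℝ] ℝ :=
  let D : E →L[ℝ] E := mfderiv 𝓘(ℝ, E) I (extChartAt I x).symm y
  let G : E →L[ℝ] E →L[ℝ] ℝ := g.inner ((extChartAt I x).symm y)
  G.bilinearComp D D

/-- The curvature tensor `R_x` of the Levi-Civita connection of `g`, computed in the preferred
chart at `x`, whose derivative at `x` is the identification of the tangent space at `x` with `E`
that Mathlib builds into the definition of `TangentSpace`. -/
def curvatureTensor (g : SmoothRiemannianMetric I M) (x : M) :
    TangentSpace I x →ₗ[ℝ] TangentSpace I x →ₗ[ℝ] TangentSpace I x →ₗ[ℝ] TangentSpace I x :=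
  (coordCurvature (chartMetric g x) (extChartAt I x x) : E →ₗ[ℝ] E →ₗ[ℝ] E →ₗ[ℝ] E)

variable [FiniteDimensional ℝ E]

/-- The pointwise moment `Ψ_k(R_x)`, formed in the euclidean vector space `(T_x M, g_x)`. -/
def pointwiseMoment (g : SmoothRiemannianMetric I M) (k : ℕ) (x : M) : ℝ :=
  letI : RiemannianBundle (fun x : M => TangentSpace I x) := ⟨g.toRiemannianMetric⟩
  haveI : FiniteDimensional ℝ (TangentSpace I x) := inferInstanceAs (FiniteDimensional ℝ E)
  sectionalMoment (V := TangentSpace I x) k (curvatureTensor g x)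

variable [MeasurableSpace E] [BorelSpace E] [MeasurableSpace M] [BorelSpace M]

/-- The Riemannian volume on the domain of the preferred chart at `x`, extended by zero: in
coordinates it is `√(det g_{ij}) dy`, where `g_{ij}` and the Lebesgue measure `dy` are formed with
respect to the same basis of `E`, which may be arbitrary. -/
def chartVolume (g : SmoothRiemannianMetric I M) (x : M) : Measure M :=
  let b := Module.finBasis ℝ E
  Measure.map (extChartAt I x).symm
    ((b.addHaar.restrict (extChartAt I x).target).withDensity fun y =>
      ENNReal.ofReal √(Matrix.of fun i j => chartMetric g x y (b i) (b j)).det)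

/-- The Riemannian volume measure. The measures `chartVolume g x` are the restrictions of the volume
measure to the chart domains, hence the volume measure of a second countable manifold is their
supremum in the complete lattice of measures. -/
def riemannianVolume (g : SmoothRiemannianMetric I M) : Measure M :=
  ⨆ x : M, chartVolume g x

/-- The `k`-th integrated moment `(1 / Vol M) ∫_M Ψ_k(R_x) vol_g(x)`. -/
def integratedMoment (g : SmoothRiemannianMetric I M) (k : ℕ) : ℝ :=
  ⨍ x, pointwiseMoment g k x ∂(riemannianVolume g)

end Manifold

/-! ### Riemannian products -/

section Product

variable {E : Type*} [NormedAddCommGroup E] [NormedSpace ℝ E]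
  {H : Type*} [TopologicalSpace H] {I : ModelWithCorners ℝ E H}
  {M : Type*} [TopologicalSpace M] [ChartedSpace H M] [IsManifold I ∞ M]
  {F : Type*} [NormedAddCommGroup F] [NormedSpace ℝ F]
  {H' : Type*} [TopologicalSpace H'] {J : ModelWithCorners ℝ F H'}
  {N : Type*} [TopologicalSpace N] [ChartedSpace H' N] [IsManifold J ∞ N]

/-- The direct sum `(v, w) ↦ G(v.1, w.1) + K(v.2, w.2)` of two bilinear forms. -/
def prodInner (G : E →L[ℝ] E →L[ℝ] ℝ) (K : F →L[ℝ] F →L[ℝ] ℝ) :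
    (E × F) →L[ℝ] (E × F) →L[ℝ] ℝ :=
  G.bilinearComp (ContinuousLinearMap.fst ℝ E F) (ContinuousLinearMap.fst ℝ E F) +
    K.bilinearComp (ContinuousLinearMap.snd ℝ E F) (ContinuousLinearMap.snd ℝ E F)

lemma tangentCoordChange_prod (x y z : M × N) (hx : z ∈ (extChartAt (I.prod J) x).source)
    (hy : z ∈ (extChartAt (I.prod J) y).source) :
    tangentCoordChange (I.prod J) x y z =
      (tangentCoordChange I x.1 y.1 z.1).prodMap (tangentCoordChange J x.2 y.2 z.2) := by
  have : IsManifold I 1 M := IsManifold.of_le (n := ∞) (by simp)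
  have : IsManifold J 1 N := IsManifold.of_le (n := ∞) (by simp)
  rw [extChartAt_prod] at hx hy
  have h1 := hasFDerivWithinAt_tangentCoordChange (I := I) (x := x.1) (y := y.1) (z := z.1)
    ⟨hx.1, hy.1⟩
  have h2 := hasFDerivWithinAt_tangentCoordChange (I := J) (x := x.2) (y := y.2) (z := z.2)
    ⟨hx.2, hy.2⟩
  have h3 := HasFDerivWithinAt.prodMap (p := (extChartAt I x.1 z.1, extChartAt J x.2 z.2))
    (s := range (I.prod J))
    (h1.mono (s := Prod.fst '' range (I.prod J)) ?_)
    (h2.mono (s := Prod.snd '' range (I.prod J)) ?_)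
  rotate_left
  · rintro _ ⟨_, ⟨a, rfl⟩, rfl⟩
    exact ⟨a.1, rfl⟩
  · rintro _ ⟨_, ⟨a, rfl⟩, rfl⟩
    exact ⟨a.2, rfl⟩
  rw [tangentCoordChange_def]
  simp only [extChartAt_prod]
  exact h3.fderivWithin
    ((I.prod J).uniqueDiffOn _ ⟨((chartAt H x.1 z.1), (chartAt H' x.2 z.2)), rfl⟩)

lemma trivializationAt_bilinear_apply (x y : M)
    (G : TangentSpace I y →L[ℝ] TangentSpace I y →L[ℝ] ℝ)
    (hy : y ∈ (chartAt H x).source) (v w : E) :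
    (trivializationAt (E →L[ℝ] E →L[ℝ] ℝ)
      (fun x : M => TangentSpace I x →L[ℝ] TangentSpace I x →L[ℝ] ℝ) x ⟨y, G⟩).2 v w =
      G (tangentCoordChange I x y y v) (tangentCoordChange I x y y w) := by
  have h0 : y ∈ (trivializationAt E (TangentSpace I) x).baseSet := by simpa using hy
  have h1 := TangentBundle.symmL_trivializationAt_eq_core (I := I) (b₀ := x) hy
  rw [hom_trivializationAt_apply, inCoordinates_apply_eq₂ h0 h0 (by simp)]
  have h2 (v : E) : (trivializationAt E (TangentSpace I) x).symm y v =
      tangentCoordChange I x y y v := by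
    rw [← Trivialization.symmL_apply (R := ℝ) _ h0, h1]
    rfl
  rw [h2, h2]
  simp

lemma contMDiff_prodInner (g : SmoothRiemannianMetric I M) (h : SmoothRiemannianMetric J N) :
    ContMDiff (I.prod J) ((I.prod J).prod 𝓘(ℝ, E × F →L[ℝ] E × F →L[ℝ] ℝ)) ∞
      (fun z : M × N => TotalSpace.mk' (E × F →L[ℝ] E × F →L[ℝ] ℝ)
        (E := fun z : M × N => TangentSpace (I.prod J) z →L[ℝ] TangentSpace (I.prod J) z →L[ℝ] ℝ) z
        (prodInner (g.inner z.1) (h.inner z.2) : (E × F) →L[ℝ] (E × F) →L[ℝ] ℝ)) := by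
  intro x
  refine (contMDiffAt_section x).2 ?_
  have hg := (contMDiffAt_section x.1).1 (g.contMDiff x.1)
  have hh := (contMDiffAt_section x.2).1 (h.contMDiff x.2)
  have hg1 := ContMDiffAt.comp (I := I.prod J) x hg contMDiffAt_fst
  have hh1 := ContMDiffAt.comp (I := I.prod J) x hh contMDiffAt_snd
  have hP : ContDiff ℝ ∞ (fun P : (E →L[ℝ] E →L[ℝ] ℝ) × (F →L[ℝ] F →L[ℝ] ℝ) =>
      prodInner P.1 P.2) := by
    have h1 (P : (E →L[ℝ] E →L[ℝ] ℝ) × (F →L[ℝ] F →L[ℝ] ℝ)) : prodInner P.1 P.2 =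
        ((ContinuousLinearMap.compL ℝ (E × F) E ℝ).flip (.fst ℝ E F) ∘L P.1 ∘L .fst ℝ E F) +
        ((ContinuousLinearMap.compL ℝ (E × F) F ℝ).flip (.snd ℝ E F) ∘L P.2 ∘L .snd ℝ E F) := by
      ext <;> simp [prodInner]
    simp only [h1]
    fun_prop
  have key := hP.contMDiff.contMDiffAt.comp x (hg1.prodMk_space hh1)
  refine key.congr_of_eventuallyEq ?_
  have hs : (chartAt (ModelProd H H') x).source ∈ nhds x := chart_source_mem_nhds _ x
  filter_upwards [hs] with y hy
  have hy1 : y.1 ∈ (chartAt H x.1).source ∧ y.2 ∈ (chartAt H' x.2).source := by simpa using hy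
  refine ContinuousLinearMap.ext fun v => ContinuousLinearMap.ext fun w => ?_
  have e1 := trivializationAt_bilinear_apply (I := I.prod J) x y
    (prodInner (g.inner y.1) (h.inner y.2) : (E × F) →L[ℝ] (E × F) →L[ℝ] ℝ) hy v w
  have e2 := trivializationAt_bilinear_apply (I := I) x.1 y.1 (g.inner y.1) hy1.1 v.1 w.1
  have e3 := trivializationAt_bilinear_apply (I := J) x.2 y.2 (h.inner y.2) hy1.2 v.2 w.2
  refine e1.trans ?_
  rw [tangentCoordChange_prod x y y (by simpa using hy) (by simp)]
  exact (congrArg₂ (· + ·) e2 e3).symm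

lemma riemannianMetric_nonneg (g : SmoothRiemannianMetric I M) (x : M) (v : TangentSpace I x) :
    0 ≤ g.inner x v v := by
  by_cases hv : v = 0
  · rw [hv, map_zero]
  · exact (g.pos x v hv).le

open Bornology in
/-- The product metric `g ⊕ h` on `M × N`, given by
`(g ⊕ h)_{(p, q)}(X, Y) = g_p(pr_M X, pr_M Y) + h_q(pr_N X, pr_N Y)`. -/
def prodMetric (g : SmoothRiemannianMetric I M) (h : SmoothRiemannianMetric J N) :
    SmoothRiemannianMetric (I.prod J) (M × N) where
  inner z := (prodInner (g.inner z.1) (h.inner z.2) : (E × F) →L[ℝ] (E × F) →L[ℝ] ℝ)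
  symm z v w := congrArg₂ (· + ·) (g.symm z.1 v.1 w.1) (h.symm z.2 v.2 w.2)
  pos z v hv := by
    change 0 < g.inner z.1 v.1 v.1 + h.inner z.2 v.2 v.2
    have h1 := riemannianMetric_nonneg g z.1 v.1
    have h2 := riemannianMetric_nonneg h z.2 v.2
    by_cases h3 : (v.1 : TangentSpace I z.1) = 0
    · have h4 : (v.2 : TangentSpace J z.2) ≠ 0 := fun h4 => hv (Prod.ext h3 h4)
      linarith [h.pos z.2 v.2 h4]
    · linarith [g.pos z.1 v.1 h3]
  isVonNBounded z := by
    have hb := g.isVonNBounded z.1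
    have hc := h.isVonNBounded z.2
    change IsVonNBounded ℝ {v : E | (g.inner z.1 v v : ℝ) < 1} at hb
    change IsVonNBounded ℝ {v : F | (h.inner z.2 v v : ℝ) < 1} at hc
    change IsVonNBounded ℝ {v : E × F | (g.inner z.1 v.1 v.1 : ℝ) + h.inner z.2 v.2 v.2 < 1}
    rw [NormedSpace.isVonNBounded_iff] at *
    refine (hb.prod hc).subset fun v hv => ?_
    have h1 : (0 : ℝ) ≤ g.inner z.1 v.1 v.1 := riemannianMetric_nonneg g z.1 v.1
    have h2 : (0 : ℝ) ≤ h.inner z.2 v.2 v.2 := riemannianMetric_nonneg h z.2 v.2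
    have hv : (g.inner z.1 v.1 v.1 : ℝ) + h.inner z.2 v.2 v.2 < 1 := hv
    exact ⟨lt_of_le_of_lt (by linarith) hv, lt_of_le_of_lt (by linarith) hv⟩
  contMDiff := contMDiff_prodInner g h

end Product

end

/-!
The three assertions are local or fibrewise, so everything is reduced to formulas in charts.

*Curvature.* In the product of two charts the product metric is the direct sum of the two coordinate
metrics, hence so are the derivative of the metric, the Christoffel symbols and the curvature tensor
(`coordCurvature_prod`, `curvatureTensor_prodMetric`).

*Pointwise moments.* The Jacobi operators of a direct sum of curvature tensors are block diagonal, so the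
generating function of the direct sum is, near the origin, the product of the two generating functions
(`momentGeneratingFunction_prod`). The Laplacian of an orthogonal sum is the sum of the two Laplacians,
which act on different variables, and the binomial theorem expands its powers
(`iterate_metricLaplacian_mul`). The falling factorials are nonzero because `m, n ≥ 2`.
To avoid orthonormal bases and to let the scalar product vary, the Laplacian of a scalar product `G`
is written as the trace of `G⁻¹ ∘ D²f` (`metricLaplacian`, `laplacian_eq_metricLaplacian`).

*Integrated moments.* The curvature tensor at a point is defined through the preferred chart at that
point, which varies with the point without any regularity. Continuity of the pointwise moments
therefore rests on the naturality of the curvature tensor under coordinate changes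
(`coordCurvature_pullback`), by which the pointwise moments near `x` are computed in the chart at
`x` (`pointwiseMoment_eq_chart`), together with the smooth dependence of the moments on the scalar
product and the curvature tensor (`contDiffAt_coordMoment`). By the change of variables formula the
volumes of two charts agree on the overlap (`chartVolume_eq_of_subset`), so the Riemannian volume
restricts to the volume of each chart, is locally finite, and is a product measure for the product
metric (`riemannianVolume_prodMetric`). The formula then follows from the pointwise one by Fubini.
-/

noncomputable section

/-! ### Laplacians and moments of bilinear forms -/

section Laplacian

variable {E : Type*} [NormedAddCommGroup E] [NormedSpace ℝ E]
  {F : Type*} [NormedAddCommGroup F] [NormedSpace ℝ F]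

/-- The operator `f ↦ ∑ G^{ij} ∂_i ∂_j f` belonging to a bilinear form `G` on a vector space,
written without coordinates as the trace of `G⁻¹ ∘ D²f`. -/
def metricLaplacian (G : E →L[ℝ] E →L[ℝ] ℝ) (f : E → ℝ) (x : E) : ℝ :=
  LinearMap.trace ℝ E ((G.inverse ∘L fderiv ℝ (fderiv ℝ f) x : E →L[ℝ] E) : E →ₗ[ℝ] E)

/-- The number `Ψ_k(R)`, formed with respect to an arbitrary bilinear form `G` on a vector space
whose norm need not be the one of `G`. -/
def coordMoment (k : ℕ) (G : E →L[ℝ] E →L[ℝ] ℝ) (R : E →ₗ[ℝ] E →ₗ[ℝ] E →ₗ[ℝ] E) : ℝ :=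
  ((metricLaplacian G)^[k] (momentGeneratingFunction R)) 0 /
    fallingFactorial ((Module.finrank ℝ E : ℝ) + 2 * k - 2) (2 * k)

/-- Laplacians are natural under linear isomorphisms, without any regularity of `f`. -/
lemma metricLaplacian_comp_equiv (φ : E ≃L[ℝ] F) {G : E →L[ℝ] E →L[ℝ] ℝ} {G' : F →L[ℝ] F →L[ℝ] ℝ}
    (hG : ∀ u v, G' (φ u) (φ v) = G u v) (f : F → ℝ) :
    metricLaplacian G (f ∘ φ) = metricLaplacian G' f ∘ φ := by
  -- `G = T ∘ G' ∘ φ` and `D²(f ∘ φ) = T ∘ D²f ∘ φ` for the transpose `T` of `φ`, so that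
  -- `G⁻¹ ∘ D²(f ∘ φ)` is conjugate to `G'⁻¹ ∘ D²f`.
  let T : (F →L[ℝ] ℝ) ≃L[ℝ] (E →L[ℝ] ℝ) := φ.symm.arrowCongr (ContinuousLinearEquiv.refl ℝ ℝ)
  have h1 : G = (T : (F →L[ℝ] ℝ) →L[ℝ] (E →L[ℝ] ℝ)) ∘L (G' ∘L (φ : E →L[ℝ] F)) := by
    ext u v
    simp [T, hG]
  have h2 : fderiv ℝ (f ∘ φ) = T ∘ (fderiv ℝ f ∘ φ) := by
    funext x
    rw [φ.comp_right_fderiv]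
    ext v
    simp [T]
  funext x
  have h3 : fderiv ℝ (fderiv ℝ (f ∘ φ)) x =
      (T : (F →L[ℝ] ℝ) →L[ℝ] (E →L[ℝ] ℝ)) ∘L (fderiv ℝ (fderiv ℝ f) (φ x) ∘L (φ : E →L[ℝ] F)) := by
    rw [h2, T.comp_fderiv, φ.comp_right_fderiv]
  have h4 : ((G.inverse ∘L fderiv ℝ (fderiv ℝ (f ∘ φ)) x : E →L[ℝ] E) : E →ₗ[ℝ] E) =
      φ.symm.toLinearEquiv.conj
        ((G'.inverse ∘L fderiv ℝ (fderiv ℝ f) (φ x) : F →L[ℝ] F) : F →ₗ[ℝ] F) := by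
    rw [h3, h1, ContinuousLinearMap.inverse_equiv_comp, ContinuousLinearMap.inverse_comp_equiv]
    ext u
    simp [LinearEquiv.conj_apply]
  rw [metricLaplacian, h4, LinearMap.trace_conj']
  rfl

lemma momentGeneratingFunction_comp_equiv (φ : E ≃L[ℝ] F) {R : E →ₗ[ℝ] E →ₗ[ℝ] E →ₗ[ℝ] E}
    {R' : F →ₗ[ℝ] F →ₗ[ℝ] F →ₗ[ℝ] F} (hR : ∀ u v w, R' (φ u) (φ v) (φ w) = φ (R u v w)) :
    momentGeneratingFunction R = momentGeneratingFunction R' ∘ φ := by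
  funext X
  have h1 : jacobiOperator R' (φ X) = φ.toLinearEquiv.conj (jacobiOperator R X) := by
    ext u
    obtain ⟨u, rfl⟩ := φ.surjective u
    simp [LinearEquiv.conj_apply, jacobiOperator, hR]
  have h2 (r : ℕ) : LinearMap.trace ℝ F (jacobiOperator R' (φ X) ^ r) =
      LinearMap.trace ℝ E (jacobiOperator R X ^ r) := by
    rw [h1]
    exact (congrArg _ (map_pow φ.toLinearEquiv.conjRingEquiv _ r)).symm.trans
      (LinearMap.trace_conj' _ _)
  simp [momentGeneratingFunction, h2]

/-- An isometry identifying two curvature tensors identifies their moments. -/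
lemma coordMoment_congr (k : ℕ) (φ : E ≃L[ℝ] F) {G : E →L[ℝ] E →L[ℝ] ℝ} {G' : F →L[ℝ] F →L[ℝ] ℝ}
    (hG : ∀ u v, G' (φ u) (φ v) = G u v) {R : E →ₗ[ℝ] E →ₗ[ℝ] E →ₗ[ℝ] E}
    {R' : F →ₗ[ℝ] F →ₗ[ℝ] F →ₗ[ℝ] F} (hR : ∀ u v w, R' (φ u) (φ v) (φ w) = φ (R u v w)) :
    coordMoment k G R = coordMoment k G' R' := by
  have h1 (f : F → ℝ) : (metricLaplacian G)^[k] (f ∘ φ) = (metricLaplacian G')^[k] f ∘ φ := by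
    induction k generalizing f with
    | zero => rfl
    | succ k ih => rw [Function.iterate_succ_apply, metricLaplacian_comp_equiv φ hG, ih,
        Function.iterate_succ_apply]
  rw [coordMoment, coordMoment, momentGeneratingFunction_comp_equiv φ hR, h1,
    φ.toLinearEquiv.finrank_eq]
  simp

end Laplacian

lemma isInvertible_of_forall_pos {E : Type*} [NormedAddCommGroup E] [NormedSpace ℝ E]
    [FiniteDimensional ℝ E] {G : E →L[ℝ] E →L[ℝ] ℝ} (hG : ∀ v, v ≠ 0 → 0 < G v v) :
    G.IsInvertible := by
  have hinj : Function.Injective (G : E →ₗ[ℝ] (E →L[ℝ] ℝ)) := by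
    rw [injective_iff_map_eq_zero]
    intro v hv
    by_contra h
    have h1 := hG v h
    have h2 : G v = 0 := hv
    simp [h2] at h1
  have hrank : Module.finrank ℝ E = Module.finrank ℝ (E →L[ℝ] ℝ) :=
    (Subspace.dual_finrank_eq (K := ℝ) (V := E)).symm.trans
      (LinearMap.toContinuousLinearMap (𝕜 := ℝ) (E := E) (F' := ℝ)).finrank_eq
  exact ⟨(LinearEquiv.ofInjectiveOfFinrankEq _ hinj hrank).toContinuousLinearEquiv, rfl⟩

lemma apply_inverse_apply_of_isInvertible {E F : Type*} [NormedAddCommGroup E] [NormedSpace ℝ E]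
    [NormedAddCommGroup F] [NormedSpace ℝ F] {G : E →L[ℝ] F} (hG : G.IsInvertible) (y : F) :
    G (G.inverse y) = y :=
  ((hG.inverse_apply_eq).1 rfl).symm

section Inner

variable {V : Type*} [NormedAddCommGroup V] [InnerProductSpace ℝ V] [FiniteDimensional ℝ V]

open scoped Laplacian in
lemma laplacian_eq_metricLaplacian (f : V → ℝ) : Δ f = metricLaplacian (innerSL ℝ) f := by
  funext x
  rw [InnerProductSpace.laplacian_eq_iteratedFDeriv_stdOrthonormalBasis]
  have h1 : (innerSL ℝ : V →L[ℝ] V →L[ℝ] ℝ).IsInvertible :=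
    isInvertible_of_forall_pos fun v hv => by
      rw [innerSL_apply_apply]
      exact real_inner_self_pos.2 hv
  rw [metricLaplacian, LinearMap.trace_eq_sum_inner _ (stdOrthonormalBasis ℝ V)]
  refine Finset.sum_congr rfl fun i _ => ?_
  rw [iteratedFDeriv_two_apply, real_inner_comm, ← innerSL_apply_apply ℝ]
  simp [apply_inverse_apply_of_isInvertible h1]

/-- The moments on a euclidean vector space `V` can be computed on any vector space `E` isomorphic to
`V`, regardless of the norm of `E`. -/
lemma sectionalMoment_eq_coordMoment {E : Type*} [NormedAddCommGroup E] [NormedSpace ℝ E]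
    (k : ℕ) (φ : V ≃L[ℝ] E) {G : E →L[ℝ] E →L[ℝ] ℝ} (hG : ∀ u v, G (φ u) (φ v) = inner ℝ u v)
    {R : V →ₗ[ℝ] V →ₗ[ℝ] V →ₗ[ℝ] V} {R' : E →ₗ[ℝ] E →ₗ[ℝ] E →ₗ[ℝ] E}
    (hR : ∀ u v w, R' (φ u) (φ v) (φ w) = φ (R u v w)) :
    sectionalMoment k R = coordMoment k G R' := by
  rw [← coordMoment_congr k φ (G := innerSL ℝ) (fun u v => by rw [hG]; rfl) hR,
    sectionalMoment, coordMoment]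
  rw [show (fun f : V → ℝ => Laplacian.laplacian f) = metricLaplacian (innerSL ℝ) from
    funext laplacian_eq_metricLaplacian]

end Inner

section PointwiseMoment

variable {E : Type*} [NormedAddCommGroup E] [NormedSpace ℝ E] [FiniteDimensional ℝ E]
  {H : Type*} [TopologicalSpace H] {I : ModelWithCorners ℝ E H}
  {M : Type*} [TopologicalSpace M] [ChartedSpace H M] [IsManifold I ∞ M]

/-- The tangent space with the norm of `g` and the model space with its own norm are the same vector
space; only the bilinear form `g` enters the moments. -/
lemma pointwiseMoment_eq_coordMoment (g : SmoothRiemannianMetric I M) (k : ℕ) (x : M) :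
    pointwiseMoment g k x = coordMoment (E := E) k (g.inner x) (curvatureTensor g x) := by
  let _ : RiemannianBundle (fun x : M => TangentSpace I x) := ⟨g.toRiemannianMetric⟩
  have : FiniteDimensional ℝ (TangentSpace I x) := inferInstanceAs (FiniteDimensional ℝ E)
  let L : TangentSpace I x ≃ₗ[ℝ] E := LinearEquiv.refl ℝ E
  have hL : ∀ u, L u = u := fun _ => rfl
  let φ : TangentSpace I x ≃L[ℝ] E := L.toContinuousLinearEquiv
  exact sectionalMoment_eq_coordMoment k φ (fun u v => rfl) (fun u v w => rfl)

end PointwiseMoment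

/-! ### Laplacians on products and in families -/

section ProductLaplacian
open Filter Topology

variable {E : Type*} [NormedAddCommGroup E] [NormedSpace ℝ E]
  {F : Type*} [NormedAddCommGroup F] [NormedSpace ℝ F]

lemma fderiv_fderiv_comp_affine {E' : Type*} [NormedAddCommGroup E'] [NormedSpace ℝ E']
    {Φ : E → ℝ} {L : E' →L[ℝ] E} {c : E} {a : E'} (hΦ : ContDiffAt ℝ 2 Φ (L a + c)) (u v : E') :
    fderiv ℝ (fderiv ℝ fun x => Φ (L x + c)) a u v =
      fderiv ℝ (fderiv ℝ Φ) (L a + c) (L u) (L v) := by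
  have hL : Continuous fun x => L x + c := by fun_prop
  have hLd (x : E') : HasFDerivAt (fun x => L x + c) L x := L.hasFDerivAt.add_const c
  have h1 : ∀ᶠ x in 𝓝 a, fderiv ℝ (fun x => Φ (L x + c)) x = fderiv ℝ Φ (L x + c) ∘L L := by
    have := hL.continuousAt.eventually (hΦ.eventually (by simp))
    filter_upwards [this] with x hx
    exact ((hx.differentiableAt (by simp)).hasFDerivAt.comp x (hLd x)).fderiv
  have h2 : HasFDerivAt (fderiv ℝ Φ) (fderiv ℝ (fderiv ℝ Φ) (L a + c)) (L a + c) :=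
    ((hΦ.fderiv_right (m := 1) (by norm_num)).differentiableAt (by simp)).hasFDerivAt
  have h3 := (h2.comp a (hLd a)).clm_comp (hasFDerivAt_const L a)
  rw [EventuallyEq.fderiv_eq h1]
  have h4 := h3.fderiv
  simp only [Function.comp_def] at h4
  rw [h4]
  simp

lemma metricLaplacian_const_mul (G : E →L[ℝ] E →L[ℝ] ℝ) (c : ℝ) (f : E → ℝ) (x : E) :
    metricLaplacian G (fun y => c * f y) x = c * metricLaplacian G f x := by
  have h1 (f : E → ℝ) : fderiv ℝ (c • f) = c • fderiv ℝ f := funext fun x => by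
    rw [fderiv_const_smul_field]
  have h2 : fderiv ℝ (fderiv ℝ (c • f)) x = c • fderiv ℝ (fderiv ℝ f) x := by
    rw [h1, fderiv_const_smul_field]
    rfl
  change metricLaplacian G (c • f) x = _
  rw [metricLaplacian, metricLaplacian, h2]
  simp

lemma metricLaplacian_sum (G : E →L[ℝ] E →L[ℝ] ℝ) {ι : Type*} (s : Finset ι) {f : ι → E → ℝ} {x : E}
    (hf : ∀ i ∈ s, ContDiffAt ℝ 2 (f i) x) :
    metricLaplacian G (fun y => ∑ i ∈ s, f i y) x = ∑ i ∈ s, metricLaplacian G (f i) x := by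
  have h1 : fderiv ℝ (fun y => ∑ i ∈ s, f i y) =ᶠ[𝓝 x] fun y => ∑ i ∈ s, fderiv ℝ (f i) y := by
    have : ∀ᶠ y in 𝓝 x, ∀ i ∈ s, ContDiffAt ℝ 2 (f i) y :=
      (Finset.eventually_all s).2 fun i hi => (hf i hi).eventually (by simp)
    filter_upwards [this] with y hy
    exact fderiv_fun_sum fun i hi => (hy i hi).differentiableAt (by simp)
  have h2 : fderiv ℝ (fderiv ℝ (fun y => ∑ i ∈ s, f i y)) x =
      ∑ i ∈ s, fderiv ℝ (fderiv ℝ (f i)) x := by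
    rw [h1.fderiv_eq]
    exact fderiv_fun_sum fun i hi =>
      ((hf i hi).fderiv_right (m := 1) (by norm_num)).differentiableAt (by simp)
  simp only [metricLaplacian, h2]
  rw [← map_sum]
  congr 1
  ext u
  simp

lemma metricLaplacian_eventuallyEq (G : E →L[ℝ] E →L[ℝ] ℝ) {f f' : E → ℝ} {x : E}
    (h : f =ᶠ[𝓝 x] f') : metricLaplacian G f =ᶠ[𝓝 x] metricLaplacian G f' := by
  have h1 : fderiv ℝ (fderiv ℝ f) =ᶠ[𝓝 x] fderiv ℝ (fderiv ℝ f') := h.fderiv.fderiv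
  filter_upwards [h1] with y hy
  rw [metricLaplacian, hy, metricLaplacian]

lemma iterate_metricLaplacian_eventuallyEq (G : E →L[ℝ] E →L[ℝ] ℝ) {f f' : E → ℝ} {x : E}
    (h : f =ᶠ[𝓝 x] f') (k : ℕ) :
    (metricLaplacian G)^[k] f =ᶠ[𝓝 x] (metricLaplacian G)^[k] f' := by
  induction k with
  | zero => exact h
  | succ k ih =>
    simpa only [Function.iterate_succ_apply'] using metricLaplacian_eventuallyEq G ih

variable [FiniteDimensional ℝ E] [FiniteDimensional ℝ F]

lemma trace_prod_eq (T : E × F →ₗ[ℝ] E × F) :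
    LinearMap.trace ℝ (E × F) T =
      LinearMap.trace ℝ E (LinearMap.fst ℝ E F ∘ₗ T ∘ₗ LinearMap.inl ℝ E F) +
      LinearMap.trace ℝ F (LinearMap.snd ℝ E F ∘ₗ T ∘ₗ LinearMap.inr ℝ E F) := by
  have h1 : T = T ∘ₗ (LinearMap.inl ℝ E F ∘ₗ LinearMap.fst ℝ E F) +
      T ∘ₗ (LinearMap.inr ℝ E F ∘ₗ LinearMap.snd ℝ E F) := by
    ext <;> simp [← Prod.zero_eq_mk]
  conv_lhs => rw [h1]
  rw [map_add, ← LinearMap.comp_assoc, ← LinearMap.comp_assoc,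
    LinearMap.trace_comp_comm', LinearMap.trace_comp_comm' (LinearMap.snd ℝ E F)]

lemma prodInner_inverse {G : E →L[ℝ] E →L[ℝ] ℝ} {K : F →L[ℝ] F →L[ℝ] ℝ} (hG : G.IsInvertible)
    (hK : K.IsInvertible) : (prodInner G K).IsInvertible ∧ ∀ l : E × F →L[ℝ] ℝ,
      (prodInner G K).inverse l =
        (G.inverse (l ∘L .inl ℝ E F), K.inverse (l ∘L .inr ℝ E F)) := by
  let T : (E × F →L[ℝ] ℝ) →ₗ[ℝ] E × F :=
    { toFun l := (G.inverse (l ∘L .inl ℝ E F), K.inverse (l ∘L .inr ℝ E F))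
      map_add' l l' := by simp
      map_smul' c l := by simp }
  let T' : (E × F →L[ℝ] ℝ) →L[ℝ] E × F := LinearMap.toContinuousLinearMap T
  have hT (l) : T' l = (G.inverse (l ∘L .inl ℝ E F), K.inverse (l ∘L .inr ℝ E F)) := rfl
  have h1 : (prodInner G K) ∘L T' = .id ℝ _ := by
    ext l v <;>
    simp [prodInner, hT, apply_inverse_apply_of_isInvertible hG,
      apply_inverse_apply_of_isInvertible hK, ← Prod.zero_eq_mk]
  have h2 : T' ∘L prodInner G K = .id ℝ _ := by
    have a1 (v : E × F) : prodInner G K v ∘L .inl ℝ E F = G v.1 := by ext; simp [prodInner]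
    have a2 (v : E × F) : prodInner G K v ∘L .inr ℝ E F = K v.2 := by ext; simp [prodInner]
    refine ContinuousLinearMap.ext fun v => ?_
    rw [ContinuousLinearMap.comp_apply, hT, a1, a2, (hG.inverse_apply_eq).2 rfl,
      (hK.inverse_apply_eq).2 rfl]
    rfl
  refine ⟨.of_inverse h1 h2, fun l => ?_⟩
  rw [ContinuousLinearMap.inverse_eq h1 h2, hT]

/-- The Laplacian of an orthogonal sum is the sum of the Laplacians in the two variables: in the trace
of `(G ⊕ K)⁻¹ ∘ D²Φ` only the diagonal blocks of `D²Φ` survive. -/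
lemma metricLaplacian_prod {G : E →L[ℝ] E →L[ℝ] ℝ} {K : F →L[ℝ] F →L[ℝ] ℝ} (hG : G.IsInvertible)
    (hK : K.IsInvertible) {Φ : E × F → ℝ} {z : E × F} (hΦ : ContDiffAt ℝ 2 Φ z) :
    metricLaplacian (prodInner G K) Φ z =
      metricLaplacian G (fun x => Φ (x, z.2)) z.1 +
        metricLaplacian K (fun y => Φ (z.1, y)) z.2 := by
  obtain ⟨a, b⟩ := z
  have h1 (u v : E) : fderiv ℝ (fderiv ℝ fun x => Φ (x, b)) a u v =
      fderiv ℝ (fderiv ℝ Φ) (a, b) (u, 0) (v, 0) := by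
    simpa using fderiv_fderiv_comp_affine (L := .inl ℝ E F) (c := (0, b)) (a := a)
      (by simpa using hΦ) u v
  have h2 (u v : F) : fderiv ℝ (fderiv ℝ fun y => Φ (a, y)) b u v =
      fderiv ℝ (fderiv ℝ Φ) (a, b) (0, u) (0, v) := by
    simpa using fderiv_fderiv_comp_affine (L := .inr ℝ E F) (c := (a, 0)) (a := b)
      (by simpa using hΦ) u v
  rw [metricLaplacian, trace_prod_eq]
  congr 2
  · ext u
    have : fderiv ℝ (fderiv ℝ Φ) (a, b) (u, 0) ∘L .inl ℝ E F =
        fderiv ℝ (fderiv ℝ fun x => Φ (x, b)) a u := by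
      ext v; simp [h1]
    simp [(prodInner_inverse hG hK).2, this]
  · ext u
    have : fderiv ℝ (fderiv ℝ Φ) (a, b) (0, u) ∘L .inr ℝ E F =
        fderiv ℝ (fderiv ℝ fun y => Φ (a, y)) b u := by
      ext v; simp [h2]
    simp [(prodInner_inverse hG hK).2, this]

/-- The trace as a continuous linear form on the Banach algebra of endomorphisms. -/
def continuousTrace (E : Type*) [NormedAddCommGroup E] [NormedSpace ℝ E] [FiniteDimensional ℝ E] :
    (E →L[ℝ] E) →L[ℝ] ℝ :=
  LinearMap.toContinuousLinearMap (LinearMap.trace ℝ E ∘ₗ ContinuousLinearMap.coeLM ℝ)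

omit [FiniteDimensional ℝ E] in
/-- The partial derivatives of a smooth family of functions are a smooth family. -/
lemma ContDiffAt.fderiv_family {P V : Type*} [NormedAddCommGroup P] [NormedSpace ℝ P]
    [NormedAddCommGroup V] [NormedSpace ℝ V] {Ψ : P → E → V} {z : P × E}
    (hΨ : ContDiffAt ℝ ∞ (fun w : P × E => Ψ w.1 w.2) z) :
    ContDiffAt ℝ ∞ (fun w : P × E => fderiv ℝ (Ψ w.1) w.2) z := by
  refine ContDiffAt.fderiv (f := fun w : P × E => Ψ w.1) (g := Prod.snd) (n := ∞) ?_
    contDiffAt_snd (by simp)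
  exact ContDiffAt.comp (g := fun w : P × E => Ψ w.1 w.2)
    (f := fun q : (P × E) × E => (q.1.1, q.2)) (z, z.2) (by simpa using hΨ) (by fun_prop)

/-- Laplacians of a smooth family of functions, formed with a smooth family of bilinear forms, are
again a smooth family of functions. -/
lemma ContDiffAt.metricLaplacian_family {P : Type*} [NormedAddCommGroup P] [NormedSpace ℝ P]
    {G : P → E →L[ℝ] E →L[ℝ] ℝ} {Φ : P → E → ℝ} {z : P × E} (hG : ContDiffAt ℝ ∞ G z.1)
    (hGi : (G z.1).IsInvertible) (hΦ : ContDiffAt ℝ ∞ (fun w : P × E => Φ w.1 w.2) z) :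
    ContDiffAt ℝ ∞ (fun w : P × E => metricLaplacian (G w.1) (Φ w.1) w.2) z := by
  have h1 : ContDiffAt ℝ ∞ (fun w : P × E => (G w.1).inverse) z :=
    (hGi.contDiffAt_map_inverse.comp z.1 hG).comp z contDiffAt_fst
  have h2 : ContDiffAt ℝ ∞ (fun w : P × E => fderiv ℝ (fderiv ℝ (Φ w.1)) w.2) z :=
    ContDiffAt.fderiv_family (Ψ := fun p => fderiv ℝ (Φ p)) hΦ.fderiv_family
  exact (continuousTrace E).contDiff.contDiffAt.comp z (h1.clm_comp h2)

lemma ContDiffAt.iterate_metricLaplacian_family {P : Type*} [NormedAddCommGroup P] [NormedSpace ℝ P]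
    {G : P → E →L[ℝ] E →L[ℝ] ℝ} {Φ : P → E → ℝ} {z : P × E} (hG : ContDiffAt ℝ ∞ G z.1)
    (hGi : (G z.1).IsInvertible) (hΦ : ContDiffAt ℝ ∞ (fun w : P × E => Φ w.1 w.2) z) (k : ℕ) :
    ContDiffAt ℝ ∞ (fun w : P × E => (metricLaplacian (G w.1))^[k] (Φ w.1) w.2) z := by
  induction k with
  | zero => exact hΦ
  | succ k ih =>
    simpa only [Function.iterate_succ_apply'] using ContDiffAt.metricLaplacian_family
      (Φ := fun p => (metricLaplacian (G p))^[k] (Φ p)) hG hGi ih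

lemma ContDiffAt.iterate_metricLaplacian {G : E →L[ℝ] E →L[ℝ] ℝ} (hG : G.IsInvertible) {f : E → ℝ}
    {x : E} (hf : ContDiffAt ℝ ∞ f x) (k : ℕ) :
    ContDiffAt ℝ ∞ ((metricLaplacian G)^[k] f) x := by
  have h := ContDiffAt.iterate_metricLaplacian_family (P := ℝ) (G := fun _ => G) (Φ := fun _ => f)
    (z := (0, x)) contDiffAt_const hG (hf.comp (0, x) contDiffAt_snd) k
  exact h.comp (g := fun w : ℝ × E => (metricLaplacian G)^[k] f w.2)
    (f := fun y => ((0 : ℝ), y)) x (by fun_prop)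

/-- The binomial expansion of the powers of the Laplacian of an orthogonal sum, applied to a product
of functions of the two variables. -/
lemma iterate_metricLaplacian_mul {G : E →L[ℝ] E →L[ℝ] ℝ} {K : F →L[ℝ] F →L[ℝ] ℝ}
    (hG : G.IsInvertible) (hK : K.IsInvertible) {f : E → ℝ} {h : F → ℝ} {z : E × F}
    (hf : ContDiffAt ℝ ∞ f z.1) (hh : ContDiffAt ℝ ∞ h z.2) (k : ℕ) :
    (metricLaplacian (prodInner G K))^[k] (fun w => f w.1 * h w.2) =ᶠ[𝓝 z]
      fun w => ∑ i ∈ Finset.range (k + 1), (k.choose i : ℝ) *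
        ((metricLaplacian G)^[i] f w.1 * (metricLaplacian K)^[k - i] h w.2) := by
  induction k with
  | zero => simp
  | succ k ih =>
    rw [Function.iterate_succ_apply']
    refine (metricLaplacian_eventuallyEq _ ih).trans ?_
    have h1 : ∀ᶠ w : E × F in 𝓝 z, ∀ i ∈ Finset.range (k + 1),
        ContDiffAt ℝ 2 ((metricLaplacian G)^[i] f) w.1 ∧
        ContDiffAt ℝ 2 ((metricLaplacian K)^[k - i] h) w.2 := by
      refine (Finset.eventually_all _).2 fun i _ => ?_
      have a1 := ((hf.iterate_metricLaplacian hG i).of_le (m := 2)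
        (WithTop.coe_le_coe.2 le_top)).eventually (by simp)
      have a2 := ((hh.iterate_metricLaplacian hK (k - i)).of_le (m := 2)
        (WithTop.coe_le_coe.2 le_top)).eventually (by simp)
      exact (continuous_fst.continuousAt.eventually a1).and
        (continuous_snd.continuousAt.eventually a2)
    filter_upwards [h1] with w hw
    have h2 (i) (hi : i ∈ Finset.range (k + 1)) : ContDiffAt ℝ 2 (fun w : E × F =>
        (metricLaplacian G)^[i] f w.1 * (metricLaplacian K)^[k - i] h w.2) w :=
      ((hw i hi).1.comp w contDiffAt_fst).mul ((hw i hi).2.comp w contDiffAt_snd)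
    rw [metricLaplacian_sum _ _ fun i hi => contDiffAt_const.mul (h2 i hi),
      Finset.sum_choose_succ_mul
        (fun i j => (metricLaplacian G)^[i] f w.1 * (metricLaplacian K)^[j] h w.2) k,
      ← Finset.sum_add_distrib]
    refine Finset.sum_congr rfl fun i hi => ?_
    have h3 : k + 1 - i = k - i + 1 := by
      have := Finset.mem_range.1 hi
      omega
    rw [metricLaplacian_const_mul, metricLaplacian_prod hG hK (h2 i hi), h3,
      Function.iterate_succ_apply', Function.iterate_succ_apply']
    simp only [mul_comm _ ((metricLaplacian K)^[k - i] h w.2), metricLaplacian_const_mul]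
    simp only [mul_comm ((metricLaplacian K)^[k - i] h _)]
    ring

end ProductLaplacian

/-! ### The generating function -/

section GeneratingFunction
open Filter Topology

variable {E : Type*} [NormedAddCommGroup E] [NormedSpace ℝ E] [FiniteDimensional ℝ E]
  {F : Type*} [NormedAddCommGroup F] [NormedSpace ℝ F] [FiniteDimensional ℝ F]

lemma continuousTrace_pow (A : E →L[ℝ] E) (r : ℕ) :
    continuousTrace E (A ^ r) = LinearMap.trace ℝ E ((A : E →ₗ[ℝ] E) ^ r) :=
  congrArg (LinearMap.trace ℝ E) (map_pow ContinuousLinearMap.toLinearMapRingHom A r)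

lemma summable_halfLogSeries {A : E →L[ℝ] E} (hA : ‖A‖ < 1) :
    Summable fun r : ℕ => (1 / (2 * ((r : ℝ) + 1))) • A ^ (r + 1) := by
  have : CompleteSpace E := FiniteDimensional.complete ℝ E
  have h1 : Summable fun r : ℕ => ‖A‖ ^ (r + 1) :=
    (summable_nat_add_iff 1).2 (summable_geometric_of_lt_one (norm_nonneg A) hA)
  refine Summable.of_norm_bounded h1 fun r => ?_
  rw [norm_smul]
  have h2 : ‖A ^ (r + 1)‖ ≤ ‖A‖ ^ (r + 1) := norm_pow_le' A (Nat.succ_pos r)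
  have h3 : ‖(1 / (2 * ((r : ℝ) + 1)))‖ ≤ 1 := by
    rw [Real.norm_of_nonneg (by positivity), div_le_one (by positivity)]
    have : (0 : ℝ) ≤ r := r.cast_nonneg
    linarith
  calc _ ≤ 1 * ‖A‖ ^ (r + 1) := by gcongr
    _ = _ := one_mul _

lemma summable_traceSeries {A : E →L[ℝ] E} (hA : ‖A‖ < 1) :
    Summable fun r : ℕ => 1 / (2 * ((r : ℝ) + 1)) *
      LinearMap.trace ℝ E ((A : E →ₗ[ℝ] E) ^ (r + 1)) := by
  have h := (continuousTrace E).summable (summable_halfLogSeries hA)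
  simpa [continuousTrace_pow] using h

/-- The series is the trace of the convergent power series of `-log (1 - A) / 2`. -/
lemma contDiffAt_traceSeries :
    ContDiffAt ℝ ∞ (fun A : E →L[ℝ] E => ∑' r : ℕ, 1 / (2 * ((r : ℝ) + 1)) *
      LinearMap.trace ℝ E ((A : E →ₗ[ℝ] E) ^ (r + 1))) 0 := by
  -- The coefficient of index zero has the value `1 / 0 = 0`, so the constant term is absent.
  let c : ℕ → ℝ := fun n => 1 / (2 * n)
  have : CompleteSpace E := FiniteDimensional.complete ℝ E
  let p := FormalMultilinearSeries.ofScalars (E →L[ℝ] E) c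
  have hr : (1 : NNReal) ≤ p.radius := by
    refine p.le_radius_of_eventually_le 1 ?_
    filter_upwards [eventually_gt_atTop 0] with n hn
    have h1 : ‖p n‖ ≤ ‖c n‖ := FormalMultilinearSeries.ofScalars_norm_le _ c n hn
    have h2 : ‖c n‖ ≤ 1 := by
      have : (1 : ℝ) ≤ n := by exact_mod_cast hn
      rw [Real.norm_of_nonneg (by positivity), div_le_one (by positivity)]
      linarith
    simpa using h1.trans h2
  have h1 : ContDiffAt ℝ ∞ p.sum 0 :=
    (p.hasFPowerSeriesOnBall (lt_of_lt_of_le (by simp) hr)).analyticAt.contDiffAt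
  refine ((continuousTrace E).contDiff.contDiffAt.comp 0 h1).congr_of_eventuallyEq ?_
  filter_upwards [Metric.ball_mem_nhds (0 : E →L[ℝ] E) one_pos] with A hA
  have hA : ‖A‖ < 1 := by simpa using hA
  have h2 : p.sum A = ∑' n, c n • A ^ n :=
    congrFun (FormalMultilinearSeries.ofScalarsSum_eq_tsum (𝕜 := ℝ) (E := E →L[ℝ] E) (c := c)) A
  have h3 : (fun r : ℕ => c (r + 1) • A ^ (r + 1)) =
      fun r : ℕ => (1 / (2 * ((r : ℝ) + 1))) • A ^ (r + 1) := by
    funext r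
    simp [c]
  have h4 : p.sum A = ∑' r : ℕ, (1 / (2 * ((r : ℝ) + 1))) • A ^ (r + 1) := by
    rw [h2, ((summable_nat_add_iff 1).1 (h3 ▸ summable_halfLogSeries hA)).tsum_eq_zero_add, h3]
    simp [c]
  rw [Function.comp_apply, h4, (continuousTrace E).map_tsum (summable_halfLogSeries hA)]
  simp [continuousTrace_pow]

omit [FiniteDimensional ℝ E] in
lemma jacobiOperator_zero (R : E →ₗ[ℝ] E →ₗ[ℝ] E →ₗ[ℝ] E) : jacobiOperator R 0 = 0 := by
  ext; simp [jacobiOperator]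

/-- Smooth dependence of the generating function near the origin on a parameter in the curvature
tensor. -/
lemma contDiffAt_momentGeneratingFunction {P : Type*} [NormedAddCommGroup P] [NormedSpace ℝ P]
    {R : P → E →ₗ[ℝ] E →ₗ[ℝ] E →ₗ[ℝ] E} {p : P}
    (hR : ContDiffAt ℝ ∞ (fun w : P × E =>
      LinearMap.toContinuousLinearMap (jacobiOperator (R w.1) w.2)) (p, 0)) :
    ContDiffAt ℝ ∞ (fun w : P × E => momentGeneratingFunction (R w.1) w.2) (p, 0) := by
  have h1 := contDiffAt_traceSeries (E := E)
  rw [← map_zero (LinearMap.toContinuousLinearMap (𝕜 := ℝ) (E := E) (F' := E)),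
    ← jacobiOperator_zero (R p)] at h1
  exact Real.contDiff_exp.contDiffAt.comp (p, (0 : E))
    (ContDiffAt.comp (f := fun w : P × E =>
      LinearMap.toContinuousLinearMap (jacobiOperator (R w.1) w.2)) (p, (0 : E)) h1 hR)

lemma contDiff_jacobiOperator (R : E →ₗ[ℝ] E →ₗ[ℝ] E →ₗ[ℝ] E) :
    ContDiff ℝ ∞ fun X => LinearMap.toContinuousLinearMap (jacobiOperator R X) := by
  rw [contDiff_clm_apply_iff]
  intro u
  let L : E →L[ℝ] E →L[ℝ] E := LinearMap.toContinuousLinearMap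
    ((LinearMap.toContinuousLinearMap (𝕜 := ℝ) (E := E) (F' := E)).toLinearMap ∘ₗ R u)
  change ContDiff ℝ ∞ fun X => L X X
  fun_prop

lemma contDiffAt_momentGeneratingFunction_zero (R : E →ₗ[ℝ] E →ₗ[ℝ] E →ₗ[ℝ] E) :
    ContDiffAt ℝ ∞ (momentGeneratingFunction R) 0 := by
  have h := contDiffAt_momentGeneratingFunction (P := ℝ) (p := 0) (R := fun _ => R)
    ((contDiff_jacobiOperator R).comp contDiff_snd).contDiffAt
  exact h.comp (g := fun w : ℝ × E => momentGeneratingFunction R w.2) (f := fun X => ((0 : ℝ), X))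
    (0 : E) (by fun_prop)

/-- The moments depend smoothly on the scalar product and the curvature tensor. -/
lemma contDiffAt_coordMoment {P : Type*} [NormedAddCommGroup P] [NormedSpace ℝ P]
    {G : P → E →L[ℝ] E →L[ℝ] ℝ} {R : P → E →ₗ[ℝ] E →ₗ[ℝ] E →ₗ[ℝ] E} {p : P}
    (hG : ContDiffAt ℝ ∞ G p) (hGi : (G p).IsInvertible)
    (hR : ContDiffAt ℝ ∞ (fun w : P × E =>
      LinearMap.toContinuousLinearMap (jacobiOperator (R w.1) w.2)) (p, 0)) (k : ℕ) :
    ContDiffAt ℝ ∞ (fun x => coordMoment k (G x) (R x)) p := by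
  have h := ContDiffAt.iterate_metricLaplacian_family (z := (p, (0 : E)))
    (Φ := fun x => momentGeneratingFunction (R x)) hG hGi
    (contDiffAt_momentGeneratingFunction hR) k
  exact (h.comp p (f := fun x => (x, (0 : E))) (by fun_prop)).div_const _

lemma eventually_norm_jacobiOperator_lt_one (R : E →ₗ[ℝ] E →ₗ[ℝ] E →ₗ[ℝ] E) :
    ∀ᶠ X in 𝓝 (0 : E), ‖LinearMap.toContinuousLinearMap (jacobiOperator R X)‖ < 1 := by
  have h1 : ContinuousAt (fun X => ‖LinearMap.toContinuousLinearMap (jacobiOperator R X)‖) 0 :=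
    (contDiff_jacobiOperator R).continuous.norm.continuousAt
  refine h1.eventually_lt continuousAt_const ?_
  simp [jacobiOperator_zero]

/-- The Jacobi operators of a direct sum are block diagonal, so that the traces add up. -/
lemma momentGeneratingFunction_prod {R : E →ₗ[ℝ] E →ₗ[ℝ] E →ₗ[ℝ] E}
    {S : F →ₗ[ℝ] F →ₗ[ℝ] F →ₗ[ℝ] F} {Q : E × F →ₗ[ℝ] E × F →ₗ[ℝ] E × F →ₗ[ℝ] E × F}
    (hQ : ∀ X Y Z, Q X Y Z = (R X.1 Y.1 Z.1, S X.2 Y.2 Z.2)) :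
    momentGeneratingFunction Q =ᶠ[𝓝 0]
      fun w => momentGeneratingFunction R w.1 * momentGeneratingFunction S w.2 := by
  have hR := continuous_fst.continuousAt (x := (0 : E × F)).eventually
    (eventually_norm_jacobiOperator_lt_one R)
  have hS := continuous_snd.continuousAt (x := (0 : E × F)).eventually
    (eventually_norm_jacobiOperator_lt_one S)
  filter_upwards [hR, hS] with w hw1 hw2
  have h1 : jacobiOperator Q w = (jacobiOperator R w.1).prodMap (jacobiOperator S w.2) :=
    LinearMap.ext fun u => hQ u w w
  have h2 (r : ℕ) : jacobiOperator Q w ^ r =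
      (jacobiOperator R w.1 ^ r).prodMap (jacobiOperator S w.2 ^ r) := by
    rw [h1]
    induction r with
    | zero => rfl
    | succ r ih => rw [pow_succ, ih, pow_succ, pow_succ, LinearMap.prodMap_mul]
  have h3 := (summable_traceSeries hw1).tsum_add (summable_traceSeries hw2)
  simp only [LinearMap.coe_toContinuousLinearMap] at h3
  simp only [momentGeneratingFunction]
  rw [← Real.exp_add, ← h3]
  simp only [h2, LinearMap.trace_prodMap', mul_add]

lemma fallingFactorial_ne_zero {x : ℝ} {s : ℕ} (h : (s : ℝ) < x + 1) :
    fallingFactorial x s ≠ 0 := by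
  refine Finset.prod_ne_zero_iff.2 fun i hi => ?_
  have : ((i + 1 : ℕ) : ℝ) ≤ s := Nat.cast_le.2 (Finset.mem_range.1 hi)
  push_cast at this
  linarith

lemma coordMoment_prod {m n : ℕ} (hm : Module.finrank ℝ E = m) (hn : Module.finrank ℝ F = n)
    (hm2 : 2 ≤ m) (hn2 : 2 ≤ n) {G : E →L[ℝ] E →L[ℝ] ℝ} {K : F →L[ℝ] F →L[ℝ] ℝ}
    (hG : G.IsInvertible) (hK : K.IsInvertible) {R : E →ₗ[ℝ] E →ₗ[ℝ] E →ₗ[ℝ] E}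
    {S : F →ₗ[ℝ] F →ₗ[ℝ] F →ₗ[ℝ] F} {Q : E × F →ₗ[ℝ] E × F →ₗ[ℝ] E × F →ₗ[ℝ] E × F}
    (hQ : ∀ X Y Z, Q X Y Z = (R X.1 Y.1 Z.1, S X.2 Y.2 Z.2)) (k : ℕ) :
    coordMoment k (prodInner G K) Q =
      ∑ r ∈ Finset.range (k + 1), (k.choose r : ℝ) *
        (fallingFactorial ((m : ℝ) + 2 * r - 2) (2 * r) *
          fallingFactorial ((n : ℝ) + 2 * (k - r : ℕ) - 2) (2 * (k - r)) /
          fallingFactorial ((m : ℝ) + n + 2 * k - 2) (2 * k)) *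
        (coordMoment r G R * coordMoment (k - r) K S) := by
  have h1 := (iterate_metricLaplacian_eventuallyEq (prodInner G K)
    (momentGeneratingFunction_prod hQ) k).trans
    (iterate_metricLaplacian_mul (z := (0 : E × F)) hG hK
      (contDiffAt_momentGeneratingFunction_zero R) (contDiffAt_momentGeneratingFunction_zero S) k)
  have hm2' : (2 : ℝ) ≤ m := by exact_mod_cast hm2
  have hn2' : (2 : ℝ) ≤ n := by exact_mod_cast hn2
  rw [coordMoment, h1.eq_of_nhds, Module.finrank_prod, hm, hn, Finset.sum_div]
  refine Finset.sum_congr rfl fun r _ => ?_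
  have h2 : fallingFactorial ((m : ℝ) + 2 * r - 2) (2 * r) ≠ 0 :=
    fallingFactorial_ne_zero (by push_cast; linarith)
  have h3 : fallingFactorial ((n : ℝ) + 2 * (k - r : ℕ) - 2) (2 * (k - r)) ≠ 0 :=
    fallingFactorial_ne_zero (by push_cast; linarith)
  have h4 : fallingFactorial ((m : ℝ) + n + 2 * k - 2) (2 * k) ≠ 0 :=
    fallingFactorial_ne_zero (by push_cast; linarith)
  rw [coordMoment, coordMoment, hm, hn]
  push_cast
  field_simp
  simp

end GeneratingFunction

/-! ### Curvature in coordinates -/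

section CoordinateCurvature
open Filter Topology

variable {E : Type*} [NormedAddCommGroup E] [NormedSpace ℝ E]
  {F : Type*} [NormedAddCommGroup F] [NormedSpace ℝ F]

lemma minSmoothness_two_le_infty : minSmoothness ℝ 2 ≤ ∞ := by
  rw [minSmoothness_of_isRCLikeNormedField]
  exact WithTop.coe_le_coe.2 le_top

lemma koszulForm_apply (D : E →L[ℝ] E →L[ℝ] E →L[ℝ] ℝ) (u v w : E) :
    koszulForm D u v w = 1 / 2 * (D u v w + D v u w - D w u v) := by
  simp [koszulForm]

lemma ContDiffAt.clm_flip {P E₁ E₂ E₃ : Type*} [NormedAddCommGroup P] [NormedSpace ℝ P]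
    [NormedAddCommGroup E₁] [NormedSpace ℝ E₁] [NormedAddCommGroup E₂] [NormedSpace ℝ E₂]
    [NormedAddCommGroup E₃] [NormedSpace ℝ E₃] {f : P → E₁ →L[ℝ] E₂ →L[ℝ] E₃} {p : P}
    {n : WithTop ℕ∞} (hf : ContDiffAt ℝ n f p) : ContDiffAt ℝ n (fun x => (f x).flip) p :=
  (ContinuousLinearMap.flipₗᵢ ℝ E₁ E₂ E₃).contDiff.contDiffAt.comp p hf

lemma contDiff_koszulForm : ContDiff ℝ ∞ (koszulForm (E := E)) := by
  have h1 : ContDiff ℝ ∞ fun D : E →L[ℝ] E →L[ℝ] E →L[ℝ] ℝ => D.flip :=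
    (ContinuousLinearMap.flipₗᵢ ℝ E E (E →L[ℝ] ℝ)).contDiff
  have h2 : ContDiff ℝ ∞ fun D : E →L[ℝ] E →L[ℝ] E →L[ℝ] ℝ =>
      (ContinuousLinearMap.flipₗᵢ ℝ E E ℝ : (E →L[ℝ] E →L[ℝ] ℝ) →L[ℝ] (E →L[ℝ] E →L[ℝ] ℝ)) ∘L
        D.flip :=
    contDiff_const.clm_comp h1
  exact ((contDiff_id.add h1).sub h2).const_smul (1 / 2 : ℝ)

lemma christoffel_apply (G : E → E →L[ℝ] E →L[ℝ] ℝ) (y u v : E) :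
    christoffel G y u v = (G y).inverse (koszulForm (fderiv ℝ G y) u v) := rfl

lemma apply_christoffel {G : E → E →L[ℝ] E →L[ℝ] ℝ} {y : E} (hG : (G y).IsInvertible) (u v : E) :
    G y (christoffel G y u v) = koszulForm (fderiv ℝ G y) u v :=
  apply_inverse_apply_of_isInvertible hG _

lemma contDiffAt_christoffel [CompleteSpace E] {G : E → E →L[ℝ] E →L[ℝ] ℝ} {y : E}
    (hG : ContDiffAt ℝ ∞ G y) (hGi : (G y).IsInvertible) : ContDiffAt ℝ ∞ (christoffel G) y := by
  have h1 : ContDiffAt ℝ ∞ (fun y => (G y).inverse) y := hGi.contDiffAt_map_inverse.comp y hG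
  have h2 : ContDiffAt ℝ ∞ (fun y => koszulForm (fderiv ℝ G y)) y :=
    contDiff_koszulForm.contDiffAt.comp y (hG.fderiv_right (by simp))
  exact (((ContinuousLinearMap.compL ℝ E (E →L[ℝ] ℝ) E).contDiff.contDiffAt).comp y h1).clm_comp h2

lemma coordCurvature_apply (G : E → E →L[ℝ] E →L[ℝ] ℝ) (y u v w : E) :
    coordCurvature G y u v w = fderiv ℝ (christoffel G) y u v w - fderiv ℝ (christoffel G) y v u w
      + christoffel G y u (christoffel G y v w) - christoffel G y v (christoffel G y u w) := by
  simp [coordCurvature]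

lemma fderiv_apply_apply {P E₁ E₂ E₃ : Type*} [NormedAddCommGroup P] [NormedSpace ℝ P]
    [NormedAddCommGroup E₁] [NormedSpace ℝ E₁] [NormedAddCommGroup E₂] [NormedSpace ℝ E₂]
    [NormedAddCommGroup E₃] [NormedSpace ℝ E₃] {f : P → E₁ →L[ℝ] E₂ →L[ℝ] E₃} {p : P}
    (hf : DifferentiableAt ℝ f p) (u : P) (v : E₁) (w : E₂) :
    fderiv ℝ f p u v w = fderiv ℝ (fun x => f x v w) p u := by
  have h := (hf.hasFDerivAt.clm_apply (hasFDerivAt_const v p)).clm_apply (hasFDerivAt_const w p)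
  rw [h.fderiv]
  simp

lemma contDiffAt_jacobiOperator_coordCurvature [FiniteDimensional ℝ E]
    {G : E → E →L[ℝ] E →L[ℝ] ℝ} {y : E} (hG : ContDiffAt ℝ ∞ G y) (hGi : (G y).IsInvertible) :
    ContDiffAt ℝ ∞ (fun w : E × E =>
      LinearMap.toContinuousLinearMap (jacobiOperator (coordCurvature G w.1) w.2)) (y, 0) := by
  have : CompleteSpace E := FiniteDimensional.complete ℝ E
  have hΓ := contDiffAt_christoffel hG hGi
  have h1 : ContDiffAt ℝ ∞ (fun w : E × E => christoffel G w.1) (y, 0) :=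
    hΓ.comp (y, (0 : E)) contDiffAt_fst
  have h2 : ContDiffAt ℝ ∞ (fun w : E × E => fderiv ℝ (christoffel G) w.1) (y, 0) :=
    (hΓ.fderiv_right (by simp)).comp (y, (0 : E)) contDiffAt_fst
  have hX : ContDiffAt ℝ ∞ (fun w : E × E => w.2) (y, 0) := contDiffAt_snd
  have h3 := ((((h2.clm_flip.clm_apply hX).clm_flip.clm_apply hX).sub
    ((h2.clm_apply hX).clm_flip.clm_apply hX)).add
    (h1.clm_flip.clm_apply ((h1.clm_apply hX).clm_apply hX))).sub
    ((h1.clm_apply hX).clm_comp (h1.clm_flip.clm_apply hX))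
  refine h3.congr_of_eventuallyEq (Eventually.of_forall fun w => ?_)
  ext u
  simp [jacobiOperator, coordCurvature_apply]

/-! ### Naturality of the curvature under coordinate changes -/

/-- The transformation law of the Christoffel symbols under a change of coordinates `φ`. It follows
from the Koszul formula, in which the second derivatives of `φ` cancel except for one. -/
lemma christoffel_pullback {G : E → E →L[ℝ] E →L[ℝ] ℝ} {G' : F → F →L[ℝ] F →L[ℝ] ℝ} {φ : E → F}
    {y : E} (hφ : ContDiffAt ℝ ∞ φ y) (hφi : (fderiv ℝ φ y).IsInvertible)
    (hG' : DifferentiableAt ℝ G' (φ y)) (hGi : (G y).IsInvertible) (hGi' : (G' (φ y)).IsInvertible)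
    (hsymm : ∀ u v, G' (φ y) u v = G' (φ y) v u)
    (hG : G =ᶠ[𝓝 y] fun x => (G' (φ x)).bilinearComp (fderiv ℝ φ x) (fderiv ℝ φ x)) (u v : E) :
    fderiv ℝ φ y (christoffel G y u v) =
      christoffel G' (φ y) (fderiv ℝ φ y u) (fderiv ℝ φ y v) + fderiv ℝ (fderiv ℝ φ) y u v := by
  have hφ1 : HasFDerivAt φ (fderiv ℝ φ y) y := (hφ.differentiableAt (by simp)).hasFDerivAt
  have hφ2 : HasFDerivAt (fderiv ℝ φ) (fderiv ℝ (fderiv ℝ φ) y) y :=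
    ((hφ.fderiv_right (m := ∞) (by simp)).differentiableAt (by simp)).hasFDerivAt
  have hsy : ∀ a b, fderiv ℝ (fderiv ℝ φ) y a b = fderiv ℝ (fderiv ℝ φ) y b a :=
    hφ.isSymmSndFDerivAt minSmoothness_two_le_infty
  have hGd : DifferentiableAt ℝ G y := by
    refine DifferentiableAt.congr_of_eventuallyEq ?_ hG
    have h1 : DifferentiableAt ℝ (fun x => G' (φ x)) y :=
      (hG'.hasFDerivAt.comp y hφ1).differentiableAt
    have h2 := (h1.clm_comp hφ2.differentiableAt)
    have h3 : DifferentiableAt ℝ (fun x => ((G' (φ x)).comp (fderiv ℝ φ x)).flip) y :=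
      (ContinuousLinearMap.flipₗᵢ ℝ E F ℝ).differentiable.differentiableAt.comp y h2
    exact (ContinuousLinearMap.flipₗᵢ ℝ E E ℝ).differentiable.differentiableAt.comp y
      (h3.clm_comp hφ2.differentiableAt)
  have hD (a b c : E) : fderiv ℝ G y a b c =
      fderiv ℝ G' (φ y) (fderiv ℝ φ y a) (fderiv ℝ φ y b) (fderiv ℝ φ y c) +
      G' (φ y) (fderiv ℝ (fderiv ℝ φ) y a b) (fderiv ℝ φ y c) +
      G' (φ y) (fderiv ℝ φ y b) (fderiv ℝ (fderiv ℝ φ) y a c) := by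
    have h1 : (fun x => G x b c) =ᶠ[𝓝 y] fun x => G' (φ x) (fderiv ℝ φ x b) (fderiv ℝ φ x c) := by
      filter_upwards [hG] with x hx
      rw [hx]; rfl
    have h2 := (((hG'.hasFDerivAt.comp y hφ1).clm_apply
      (hφ2.clm_apply (hasFDerivAt_const b y))).clm_apply (hφ2.clm_apply (hasFDerivAt_const c y)))
    rw [fderiv_apply_apply hGd, h1.fderiv_eq]
    have h3 := h2.fderiv
    simp only [Function.comp_def] at h3
    rw [h3]
    simp
    ring
  obtain ⟨T, hT⟩ := hφi
  obtain ⟨S, hS⟩ := hGi'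
  have hinj : Function.Injective (G' (φ y)) := by rw [← hS]; exact S.injective
  have hsurj : Function.Surjective (fderiv ℝ φ y) := by rw [← hT]; exact T.surjective
  apply hinj
  refine ContinuousLinearMap.ext fun w' => ?_
  obtain ⟨w, rfl⟩ := hsurj w'
  have h1 : G' (φ y) (fderiv ℝ φ y (christoffel G y u v)) (fderiv ℝ φ y w) =
      koszulForm (fderiv ℝ G y) u v w := by
    rw [← apply_christoffel hGi, hG.eq_of_nhds]; rfl
  rw [h1, map_add, apply_christoffel ⟨S, hS⟩, koszulForm_apply, add_apply,
    koszulForm_apply, hD, hD, hD, hsy v u, hsy w u, hsy w v, hsymm (fderiv ℝ (fderiv ℝ φ) y u w),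
    hsymm (fderiv ℝ φ y v)]
  ring

/-- Naturality of the curvature tensor under a change of coordinates `φ`. In the derivative of the
transformation law of the Christoffel symbols, the third derivatives of `φ` are symmetric and hence
drop out. -/
lemma coordCurvature_pullback [FiniteDimensional ℝ E] [FiniteDimensional ℝ F]
    {G : E → E →L[ℝ] E →L[ℝ] ℝ} {G' : F → F →L[ℝ] F →L[ℝ] ℝ} {φ : E → F} {y : E}
    (hφ : ∀ᶠ x in 𝓝 y, ContDiffAt ℝ ∞ φ x) (hφi : ∀ᶠ x in 𝓝 y, (fderiv ℝ φ x).IsInvertible)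
    (hGs : ContDiffAt ℝ ∞ G y) (hG' : ∀ᶠ x in 𝓝 (φ y), ContDiffAt ℝ ∞ G' x)
    (hGi : ∀ᶠ x in 𝓝 y, (G x).IsInvertible) (hGi' : ∀ᶠ x in 𝓝 (φ y), (G' x).IsInvertible)
    (hsymm : ∀ᶠ x in 𝓝 (φ y), ∀ u v, G' x u v = G' x v u)
    (hG : G =ᶠ[𝓝 y] fun x => (G' (φ x)).bilinearComp (fderiv ℝ φ x) (fderiv ℝ φ x)) (u v w : E) :
    fderiv ℝ φ y (coordCurvature G y u v w) =
      coordCurvature G' (φ y) (fderiv ℝ φ y u) (fderiv ℝ φ y v) (fderiv ℝ φ y w) := by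
  have : CompleteSpace E := FiniteDimensional.complete ℝ E
  have : CompleteSpace F := FiniteDimensional.complete ℝ F
  have hφy := hφ.self_of_nhds
  have hφ1 : HasFDerivAt φ (fderiv ℝ φ y) y := (hφy.differentiableAt (by simp)).hasFDerivAt
  have hs1 : ContDiffAt ℝ ∞ (fderiv ℝ φ) y := hφy.fderiv_right (by simp)
  have hφ2 : HasFDerivAt (fderiv ℝ φ) (fderiv ℝ (fderiv ℝ φ) y) y :=
    (hs1.differentiableAt (by simp)).hasFDerivAt
  have hs2 : ContDiffAt ℝ ∞ (fderiv ℝ (fderiv ℝ φ)) y := hs1.fderiv_right (by simp)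
  have hφ3 : HasFDerivAt (fderiv ℝ (fderiv ℝ φ)) (fderiv ℝ (fderiv ℝ (fderiv ℝ φ)) y) y :=
    (hs2.differentiableAt (by simp)).hasFDerivAt
  have hsy3 : ∀ a b, fderiv ℝ (fderiv ℝ (fderiv ℝ φ)) y a b =
      fderiv ℝ (fderiv ℝ (fderiv ℝ φ)) y b a :=
    hs1.isSymmSndFDerivAt minSmoothness_two_le_infty
  have hsy2 : ∀ a b, fderiv ℝ (fderiv ℝ φ) y a b = fderiv ℝ (fderiv ℝ φ) y b a :=
    hφy.isSymmSndFDerivAt minSmoothness_two_le_infty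
  have hΓ : HasFDerivAt (christoffel G) (fderiv ℝ (christoffel G) y) y :=
    ((contDiffAt_christoffel hGs hGi.self_of_nhds).differentiableAt (by simp)).hasFDerivAt
  have hΓ' : HasFDerivAt (christoffel G') (fderiv ℝ (christoffel G') (φ y)) (φ y) :=
    ((contDiffAt_christoffel hG'.self_of_nhds hGi'.self_of_nhds).differentiableAt
      (by simp)).hasFDerivAt
  have hc : ContinuousAt φ y := hφy.continuousAt
  have hT : ∀ᶠ x in 𝓝 y, ∀ a b, fderiv ℝ φ x (christoffel G x a b) =
      christoffel G' (φ x) (fderiv ℝ φ x a) (fderiv ℝ φ x b) + fderiv ℝ (fderiv ℝ φ) x a b := by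
    filter_upwards [hφ, hφi, hc.eventually hG', hGi, hc.eventually hGi', hc.eventually hsymm,
      hG.eventuallyEq_nhds] with x h1 h2 h3 h4 h5 h6 h7
    exact christoffel_pullback h1 h2 (h3.differentiableAt (by simp)) h4 h5 h6 h7
  have hT0 := hT.self_of_nhds
  have hT' (a b c : E) : fderiv ℝ (fderiv ℝ φ) y a (christoffel G y b c) +
        fderiv ℝ φ y (fderiv ℝ (christoffel G) y a b c) =
      fderiv ℝ (christoffel G') (φ y) (fderiv ℝ φ y a) (fderiv ℝ φ y b) (fderiv ℝ φ y c) +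
      christoffel G' (φ y) (fderiv ℝ (fderiv ℝ φ) y a b) (fderiv ℝ φ y c) +
      christoffel G' (φ y) (fderiv ℝ φ y b) (fderiv ℝ (fderiv ℝ φ) y a c) +
      fderiv ℝ (fderiv ℝ (fderiv ℝ φ)) y a b c := by
    have h1 := hφ2.clm_apply ((hΓ.clm_apply (hasFDerivAt_const b y)).clm_apply
      (hasFDerivAt_const c y))
    have h2 := (((hΓ'.comp y hφ1).clm_apply (hφ2.clm_apply (hasFDerivAt_const b y))).clm_apply
      (hφ2.clm_apply (hasFDerivAt_const c y))).add
      ((hφ3.clm_apply (hasFDerivAt_const b y)).clm_apply (hasFDerivAt_const c y))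
    have h3 := h1.unique (h2.congr_of_eventuallyEq (hT.mono fun x hx => hx b c))
    have h4 := congrArg (fun A => A a) h3
    simp at h4
    rw [add_comm, h4]
    abel
  rw [coordCurvature_apply, coordCurvature_apply]
  have e1 := hT' u v w
  have e2 := hT' v u w
  have e3 := hT0 u (christoffel G y v w)
  have e4 := hT0 v (christoffel G y u w)
  rw [hT0 v w, map_add] at e3
  rw [hT0 u w, map_add] at e4
  rw [hsy2 v u, hsy3 v u] at e2
  -- The third derivatives cancel in `e1 - e2`, and so do the terms `Γ'(D²φ(u, v), Dφ w)`; the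
  -- remaining second derivatives are those of `e3` and `e4`.
  simp only [map_add, map_sub]
  linear_combination (norm := module) e1 - e2 + e3 - e4

/-! ### Curvature of product metrics -/

/-- The Christoffel symbols of a product metric are those of the factors. -/
lemma christoffel_prod [FiniteDimensional ℝ E] [FiniteDimensional ℝ F]
    {G : E → E →L[ℝ] E →L[ℝ] ℝ} {K : F → F →L[ℝ] F →L[ℝ] ℝ}
    {Q : E × F → E × F →L[ℝ] E × F →L[ℝ] ℝ} {z : E × F} (hG : DifferentiableAt ℝ G z.1)
    (hK : DifferentiableAt ℝ K z.2) (hQd : DifferentiableAt ℝ Q z) (hGi : (G z.1).IsInvertible)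
    (hKi : (K z.2).IsInvertible) (hQ : Q =ᶠ[𝓝 z] fun x => prodInner (G x.1) (K x.2))
    (u v : E × F) :
    christoffel Q z u v = (christoffel G z.1 u.1 v.1, christoffel K z.2 u.2 v.2) := by
  have hD (a b c : E × F) : fderiv ℝ Q z a b c =
      fderiv ℝ G z.1 a.1 b.1 c.1 + fderiv ℝ K z.2 a.2 b.2 c.2 := by
    have h1 : (fun x => Q x b c) =ᶠ[𝓝 z] fun x => G x.1 b.1 c.1 + K x.2 b.2 c.2 := by
      filter_upwards [hQ] with x hx
      rw [hx]; rfl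
    have h2 := (((hG.hasFDerivAt.comp z hasFDerivAt_fst).clm_apply
      (hasFDerivAt_const b.1 z)).clm_apply (hasFDerivAt_const c.1 z)).add
      (((hK.hasFDerivAt.comp z hasFDerivAt_snd).clm_apply
      (hasFDerivAt_const b.2 z)).clm_apply (hasFDerivAt_const c.2 z))
    rw [fderiv_apply_apply hQd, h1.fderiv_eq]
    have h3 := h2.fderiv
    simp only [Function.comp_def] at h3
    refine (congrArg (fun A => A a) h3).trans ?_
    simp
  have h1 : koszulForm (fderiv ℝ Q z) u v ∘L .inl ℝ E F = koszulForm (fderiv ℝ G z.1) u.1 v.1 := by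
    ext w
    simp [koszulForm_apply, hD]
  have h2 : koszulForm (fderiv ℝ Q z) u v ∘L .inr ℝ E F = koszulForm (fderiv ℝ K z.2) u.2 v.2 := by
    ext w
    simp [koszulForm_apply, hD]
  rw [christoffel_apply, hQ.eq_of_nhds, (prodInner_inverse hGi hKi).2, h1, h2]
  rfl

lemma coordCurvature_prod [FiniteDimensional ℝ E] [FiniteDimensional ℝ F]
    {G : E → E →L[ℝ] E →L[ℝ] ℝ} {K : F → F →L[ℝ] F →L[ℝ] ℝ}
    {Q : E × F → E × F →L[ℝ] E × F →L[ℝ] ℝ} {z : E × F} (hG : ∀ᶠ x in 𝓝 z.1, ContDiffAt ℝ ∞ G x)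
    (hK : ∀ᶠ x in 𝓝 z.2, ContDiffAt ℝ ∞ K x) (hQs : ∀ᶠ x in 𝓝 z, ContDiffAt ℝ ∞ Q x)
    (hGi : ∀ᶠ x in 𝓝 z.1, (G x).IsInvertible) (hKi : ∀ᶠ x in 𝓝 z.2, (K x).IsInvertible)
    (hQ : Q =ᶠ[𝓝 z] fun x => prodInner (G x.1) (K x.2)) (u v w : E × F) :
    coordCurvature Q z u v w =
      (coordCurvature G z.1 u.1 v.1 w.1, coordCurvature K z.2 u.2 v.2 w.2) := by
  have : CompleteSpace E := FiniteDimensional.complete ℝ E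
  have : CompleteSpace F := FiniteDimensional.complete ℝ F
  have hc1 : ContinuousAt (Prod.fst : E × F → E) z := continuousAt_fst
  have hc2 : ContinuousAt (Prod.snd : E × F → F) z := continuousAt_snd
  have hΓ : ∀ᶠ x in 𝓝 z, ∀ a b, christoffel Q x a b =
      (christoffel G x.1 a.1 b.1, christoffel K x.2 a.2 b.2) := by
    filter_upwards [hc1.eventually hG, hc2.eventually hK, hQs, hc1.eventually hGi,
      hc2.eventually hKi, hQ.eventuallyEq_nhds] with x h1 h2 h3 h4 h5 h6
    exact christoffel_prod (h1.differentiableAt (by simp)) (h2.differentiableAt (by simp))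
      (h3.differentiableAt (by simp)) h4 h5 h6
  have hQi : (Q z).IsInvertible := by
    rw [hQ.eq_of_nhds]
    exact (prodInner_inverse hGi.self_of_nhds hKi.self_of_nhds).1
  have d1 : HasFDerivAt (christoffel G) (fderiv ℝ (christoffel G) z.1) z.1 :=
    ((contDiffAt_christoffel hG.self_of_nhds hGi.self_of_nhds).differentiableAt
      (by simp)).hasFDerivAt
  have d2 : HasFDerivAt (christoffel K) (fderiv ℝ (christoffel K) z.2) z.2 :=
    ((contDiffAt_christoffel hK.self_of_nhds hKi.self_of_nhds).differentiableAt
      (by simp)).hasFDerivAt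
  have d3 : DifferentiableAt ℝ (christoffel Q) z :=
    (contDiffAt_christoffel hQs.self_of_nhds hQi).differentiableAt (by simp)
  have hD (a b c : E × F) : fderiv ℝ (christoffel Q) z a b c =
      (fderiv ℝ (christoffel G) z.1 a.1 b.1 c.1, fderiv ℝ (christoffel K) z.2 a.2 b.2 c.2) := by
    have h1 : (fun x => christoffel Q x b c) =ᶠ[𝓝 z]
        fun x => (christoffel G x.1 b.1 c.1, christoffel K x.2 b.2 c.2) :=
      hΓ.mono fun x hx => hx b c
    have h2 := (((d1.comp z hasFDerivAt_fst).clm_apply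
      (hasFDerivAt_const b.1 z)).clm_apply (hasFDerivAt_const c.1 z)).prodMk
      (((d2.comp z hasFDerivAt_snd).clm_apply
      (hasFDerivAt_const b.2 z)).clm_apply (hasFDerivAt_const c.2 z))
    rw [fderiv_apply_apply d3, h1.fderiv_eq]
    have h3 := h2.fderiv
    simp only [Function.comp_def] at h3
    refine (congrArg (fun A => A a) h3).trans ?_
    simp
  have hΓ0 := hΓ.self_of_nhds
  simp only [coordCurvature_apply, hD, hΓ0]
  rfl

end CoordinateCurvature

/-! ### Curvature and moments in charts -/

section Charts
open Filter Topology

variable {E : Type*} [NormedAddCommGroup E] [NormedSpace ℝ E]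
  {H : Type*} [TopologicalSpace H] (I : ModelWithCorners ℝ E H) [I.Boundaryless]
  {M : Type*} [TopologicalSpace M] [ChartedSpace H M]

/-- The coordinate change from the preferred chart at `x` to the preferred chart at `x'`. -/
def chartTransition (x x' : M) : E → E := extChartAt I x' ∘ (extChartAt I x).symm

/-- The domain, in the coordinates at `x`, of the coordinate change from `x` to `x'`. -/
def chartOverlap (x x' : M) : Set E :=
  (extChartAt I x).target ∩ (extChartAt I x).symm ⁻¹' (extChartAt I x').source

lemma isOpen_chartOverlap (x x' : M) : IsOpen (chartOverlap I x x') :=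
  (continuousOn_extChartAt_symm x).isOpen_inter_preimage (isOpen_extChartAt_target x)
    (isOpen_extChartAt_source x')

variable {I}

omit [I.Boundaryless] in
lemma chartTransition_mem {x x' : M} {y : E} (hy : y ∈ chartOverlap I x x') :
    chartTransition I x x' y ∈ chartOverlap I x' x := by
  refine ⟨(extChartAt I x').map_source hy.2, ?_⟩
  rw [mem_preimage, chartTransition, Function.comp_apply, (extChartAt I x').left_inv hy.2]
  exact (extChartAt I x).map_target hy.1

omit [I.Boundaryless] in
lemma extChartAt_symm_chartTransition {x x' : M} {y : E} (hy : y ∈ chartOverlap I x x') :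
    (extChartAt I x').symm (chartTransition I x x' y) = (extChartAt I x).symm y :=
  (extChartAt I x').left_inv hy.2

omit [I.Boundaryless] in
lemma chartTransition_chartTransition {x x' : M} {y : E} (hy : y ∈ chartOverlap I x x') :
    chartTransition I x' x (chartTransition I x x' y) = y := by
  rw [chartTransition, Function.comp_apply, extChartAt_symm_chartTransition hy,
    (extChartAt I x).right_inv hy.1]

omit [I.Boundaryless] in
lemma extChartAt_mem_chartOverlap {x x' z : M} (hz : z ∈ (extChartAt I x).source)
    (hz' : z ∈ (extChartAt I x').source) : extChartAt I x z ∈ chartOverlap I x x' := by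
  refine ⟨(extChartAt I x).map_source hz, ?_⟩
  rwa [mem_preimage, (extChartAt I x).left_inv hz]

omit [I.Boundaryless] in
lemma chartTransition_extChartAt {x z : M} (x' : M) (hz : z ∈ (extChartAt I x).source) :
    chartTransition I x x' (extChartAt I x z) = extChartAt I x' z := by
  rw [chartTransition, Function.comp_apply, (extChartAt I x).left_inv hz]

variable [IsManifold I ∞ M]

lemma contDiffAt_chartTransition {x x' : M} {y : E} (hy : y ∈ chartOverlap I x x') :
    ContDiffAt ℝ ∞ (chartTransition I x x') y := by
  have h := contDiffOn_ext_coord_change (I := I) (n := ∞) x' x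
  rw [PartialEquiv.trans_source, PartialEquiv.symm_source] at h
  exact h.contDiffAt ((isOpen_chartOverlap I x x').mem_nhds hy)

lemma fderiv_chartTransition_comp {x x' : M} {y : E} (hy : y ∈ chartOverlap I x x') :
    fderiv ℝ (chartTransition I x' x) (chartTransition I x x' y) ∘L
      fderiv ℝ (chartTransition I x x') y = .id ℝ E := by
  have h1 := ((contDiffAt_chartTransition hy).differentiableAt (by simp)).hasFDerivAt
  have h2 := ((contDiffAt_chartTransition (chartTransition_mem hy)).differentiableAt
    (by simp)).hasFDerivAt
  refine (h2.comp y h1).unique ((hasFDerivAt_id y).congr_of_eventuallyEq ?_)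
  filter_upwards [(isOpen_chartOverlap I x x').mem_nhds hy] with z hz
  exact chartTransition_chartTransition hz

lemma isInvertible_fderiv_chartTransition {x x' : M} {y : E} (hy : y ∈ chartOverlap I x x') :
    (fderiv ℝ (chartTransition I x x') y).IsInvertible := by
  refine .of_inverse ?_ (fderiv_chartTransition_comp hy)
  have h := fderiv_chartTransition_comp (chartTransition_mem hy)
  rwa [chartTransition_chartTransition hy] at h

lemma mdifferentiableAt_extChartAt_symm {x : M} {y : E} (hy : y ∈ (extChartAt I x).target) :
    MDifferentiableAt 𝓘(ℝ, E) I (extChartAt I x).symm y :=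
  ((contMDiffOn_extChartAt_symm (n := ∞) x).contMDiffAt
    ((isOpen_extChartAt_target x).mem_nhds hy)).mdifferentiableAt (by simp)

/-- The derivative of the inverse of the preferred chart at `x`, as an endomorphism of the model
space. -/
def chartSymmDeriv (I : ModelWithCorners ℝ E H) (x : M) (y : E) : E →L[ℝ] E :=
  mfderiv 𝓘(ℝ, E) I (extChartAt I x).symm y

/-- The metric at `z` as a bilinear form on the model space. -/
def metricForm (g : SmoothRiemannianMetric I M) (z : M) : E →L[ℝ] E →L[ℝ] ℝ := g.inner z

omit [I.Boundaryless] in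
lemma metricForm_symm (g : SmoothRiemannianMetric I M) (z : M) (u v : E) :
    metricForm g z u v = metricForm g z v u :=
  g.symm z u v

omit [I.Boundaryless] in
lemma metricForm_pos (g : SmoothRiemannianMetric I M) (z : M) {v : E} (hv : v ≠ 0) :
    0 < metricForm g z v v :=
  g.pos z v hv

omit [I.Boundaryless] in
lemma chartMetric_eq (g : SmoothRiemannianMetric I M) (x : M) (y : E) :
    chartMetric g x y = (metricForm g ((extChartAt I x).symm y)).bilinearComp
      (chartSymmDeriv I x y) (chartSymmDeriv I x y) := rfl

/-- The tangent space at a point is identified with the model space by means of the preferred chart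
at this point. -/
lemma chartSymmDeriv_eq {x : M} {y : E} (hy : y ∈ (extChartAt I x).target) :
    chartSymmDeriv I x y = fderiv ℝ (chartTransition I x ((extChartAt I x).symm y)) y := by
  refine (mdifferentiableAt_extChartAt_symm hy).mfderiv.trans ?_
  simp only [writtenInExtChartAt, mfld_simps, fderivWithin_univ]
  rfl

/-- The metric read in two charts. -/
lemma chartMetric_eq_pullback (g : SmoothRiemannianMetric I M) {x x' : M} {y : E}
    (hy : y ∈ chartOverlap I x x') :
    chartMetric g x y = (chartMetric g x' (chartTransition I x x' y)).bilinearComp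
      (fderiv ℝ (chartTransition I x x') y) (fderiv ℝ (chartTransition I x x') y) := by
  have hz := extChartAt_symm_chartTransition hy
  have hy' := chartTransition_mem hy
  have h2 : chartSymmDeriv I x y = chartSymmDeriv I x' (chartTransition I x x' y) ∘L
      fderiv ℝ (chartTransition I x x') y := by
    rw [chartSymmDeriv_eq hy.1, chartSymmDeriv_eq hy'.1, hz]
    have h4 : chartTransition I x x' y ∈ chartOverlap I x' ((extChartAt I x).symm y) :=
      ⟨hy'.1, by rw [mem_preimage, hz]; exact mem_extChartAt_source _⟩
    have h5 := ((contDiffAt_chartTransition h4).differentiableAt (by simp)).hasFDerivAt.comp y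
      ((contDiffAt_chartTransition hy).differentiableAt (by simp)).hasFDerivAt
    refine (h5.congr_of_eventuallyEq ?_).fderiv
    filter_upwards [(isOpen_chartOverlap I x x').mem_nhds hy] with a ha
    rw [Function.comp_apply, chartTransition, Function.comp_apply, chartTransition,
      Function.comp_apply, extChartAt_symm_chartTransition ha]
  rw [chartMetric_eq, chartMetric_eq, h2, hz]
  rfl

lemma chartMetric_self (g : SmoothRiemannianMetric I M) (x : M) :
    chartMetric g x (extChartAt I x x) = metricForm g x := by
  have h1 : chartSymmDeriv I x (extChartAt I x x) = .id ℝ E := by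
    rw [chartSymmDeriv_eq (mem_extChartAt_target x), extChartAt_to_inv]
    refine ((hasFDerivAt_id _).congr_of_eventuallyEq ?_).fderiv
    filter_upwards [extChartAt_target_mem_nhds (I := I) x] with y hy
    exact (extChartAt I x).right_inv hy
  rw [chartMetric_eq, h1, extChartAt_to_inv]
  rfl

/-- In the trivialization at `x` which defines smoothness of `g`, the components of `g` are the ones
in the preferred chart at `x`. -/
lemma contDiffAt_chartMetric_self (g : SmoothRiemannianMetric I M) (x : M) :
    ContDiffAt ℝ ∞ (chartMetric g x) (extChartAt I x x) := by
  have h1 := (contMDiffAt_section x).1 (g.contMDiff x)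
  have h2 : ContMDiffAt 𝓘(ℝ, E) I ∞ (extChartAt I x).symm (extChartAt I x x) :=
    (contMDiffOn_extChartAt_symm x).contMDiffAt (extChartAt_target_mem_nhds x)
  have h4 := ContMDiffAt.comp_of_eq h1 h2 (extChartAt_to_inv x)
  refine h4.contDiffAt.congr_of_eventuallyEq ?_
  filter_upwards [extChartAt_target_mem_nhds (I := I) x] with y hy
  have h3 : (extChartAt I x).symm y ∈ (chartAt H x).source := by
    simpa using (extChartAt I x).map_target hy
  have h5 : chartSymmDeriv I x y =
      tangentCoordChange I x ((extChartAt I x).symm y) ((extChartAt I x).symm y) := by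
    rw [chartSymmDeriv_eq hy, tangentCoordChange_def, (extChartAt I x).right_inv hy,
      I.range_eq_univ, fderivWithin_univ]
    rfl
  refine ContinuousLinearMap.ext fun u => ContinuousLinearMap.ext fun v => ?_
  rw [chartMetric_eq, h5]
  exact (trivializationAt_bilinear_apply x _ (g.inner _) h3 u v).symm

omit [I.Boundaryless] [IsManifold I ∞ M] in
lemma symm_mem_chartOverlap {x : M} {y : E} (hy : y ∈ (extChartAt I x).target) :
    y ∈ chartOverlap I x ((extChartAt I x).symm y) :=
  ⟨hy, mem_extChartAt_source _⟩

lemma chartMetric_eventuallyEq_pullback (g : SmoothRiemannianMetric I M) {x x' : M} {y : E}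
    (hy : y ∈ chartOverlap I x x') :
    chartMetric g x =ᶠ[𝓝 y] fun z => (chartMetric g x' (chartTransition I x x' z)).bilinearComp
      (fderiv ℝ (chartTransition I x x') z) (fderiv ℝ (chartTransition I x x') z) := by
  filter_upwards [(isOpen_chartOverlap I x x').mem_nhds hy] with z hz
  exact chartMetric_eq_pullback g hz

/-- Smoothness on the whole chart domain follows from smoothness at the base point of a chart, by
changing to the preferred chart at the point under consideration. -/
lemma contDiffAt_chartMetric (g : SmoothRiemannianMetric I M) {x : M} {y : E}
    (hy : y ∈ (extChartAt I x).target) : ContDiffAt ℝ ∞ (chartMetric g x) y := by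
  have hy' := symm_mem_chartOverlap hy
  have h1 := contDiffAt_chartTransition hy'
  have h2 : ContDiffAt ℝ ∞ (fderiv ℝ (chartTransition I x ((extChartAt I x).symm y))) y :=
    h1.fderiv_right (by simp)
  have h3 := (contDiffAt_chartMetric_self g ((extChartAt I x).symm y)).comp y
    (f := chartTransition I x ((extChartAt I x).symm y)) h1
  exact ((h3.clm_comp h2).clm_flip.clm_comp h2).clm_flip.congr_of_eventuallyEq
    (chartMetric_eventuallyEq_pullback g hy')

omit [I.Boundaryless] in
lemma chartMetric_symm (g : SmoothRiemannianMetric I M) (x : M) (y u v : E) :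
    chartMetric g x y u v = chartMetric g x y v u := by
  rw [chartMetric_eq]
  exact metricForm_symm g _ _ _

lemma chartMetric_pos (g : SmoothRiemannianMetric I M) {x : M} {y : E}
    (hy : y ∈ (extChartAt I x).target) {v : E} (hv : v ≠ 0) : 0 < chartMetric g x y v v := by
  have hy' := symm_mem_chartOverlap hy
  obtain ⟨T, hT⟩ := isInvertible_fderiv_chartTransition hy'
  rw [chartMetric_eq_pullback g hy', ← hT]
  have h1 : chartTransition I x ((extChartAt I x).symm y) y =
    extChartAt I ((extChartAt I x).symm y) ((extChartAt I x).symm y) := rfl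
  rw [h1, chartMetric_self]
  exact metricForm_pos g _ ((map_ne_zero_iff T T.injective).2 hv)

variable [FiniteDimensional ℝ E]

lemma isInvertible_chartMetric (g : SmoothRiemannianMetric I M) {x : M} {y : E}
    (hy : y ∈ (extChartAt I x).target) : (chartMetric g x y).IsInvertible :=
  isInvertible_of_forall_pos fun _ hv => chartMetric_pos g hy hv

/-- The pointwise moments can be computed in an arbitrary chart. -/
lemma pointwiseMoment_eq_chart (g : SmoothRiemannianMetric I M) (k : ℕ) {x z : M}
    (hz : z ∈ (extChartAt I x).source) :
    pointwiseMoment g k z = coordMoment k (chartMetric g x (extChartAt I x z))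
      (coordCurvature (chartMetric g x) (extChartAt I x z)) := by
  have hy := extChartAt_mem_chartOverlap hz (mem_extChartAt_source (I := I) z)
  have hφ := chartTransition_extChartAt z hz
  set y := extChartAt I x z
  obtain ⟨T, hT⟩ := isInvertible_fderiv_chartTransition hy
  have ho := (isOpen_chartOverlap I x z).mem_nhds hy
  have ht : ∀ᶠ a in 𝓝 (chartTransition I x z y), a ∈ (extChartAt I z).target :=
    (isOpen_extChartAt_target z).mem_nhds (chartTransition_mem hy).1
  rw [pointwiseMoment_eq_coordMoment]
  refine (coordMoment_congr k T (fun u v => ?_) fun u v w => ?_).symm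
  · rw [chartMetric_eq_pullback g hy, ← hT, hφ, chartMetric_self]
    rfl
  · have h := coordCurvature_pullback (φ := chartTransition I x z) (y := y)
      (G := chartMetric g x) (G' := chartMetric g z)
      (mem_of_superset ho fun a ha => contDiffAt_chartTransition ha)
      (mem_of_superset ho fun a ha => isInvertible_fderiv_chartTransition ha)
      (contDiffAt_chartMetric g hy.1) (ht.mono fun a ha => contDiffAt_chartMetric g ha)
      (mem_of_superset ho fun a ha => isInvertible_chartMetric g ha.1)
      (ht.mono fun a ha => isInvertible_chartMetric g ha)
      (Eventually.of_forall (chartMetric_symm g z)) (chartMetric_eventuallyEq_pullback g hy) u v w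
    rw [← hT, hφ] at h
    exact h.symm

/-- Near `x` the pointwise moments are moments of the coordinate metric and of the coordinate
curvature in the fixed chart at `x`, which are smooth. -/
lemma continuous_pointwiseMoment (g : SmoothRiemannianMetric I M) (k : ℕ) :
    Continuous (pointwiseMoment g k) := by
  refine continuous_iff_continuousAt.2 fun x => ?_
  have h1 : ContinuousAt (fun y => coordMoment k (chartMetric g x y)
      (coordCurvature (chartMetric g x) y)) (extChartAt I x x) :=
    (contDiffAt_coordMoment (contDiffAt_chartMetric_self g x)
      (isInvertible_chartMetric g (mem_extChartAt_target x))
      (contDiffAt_jacobiOperator_coordCurvature (contDiffAt_chartMetric_self g x)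
        (isInvertible_chartMetric g (mem_extChartAt_target x))) k).continuousAt
  refine (h1.comp (f := extChartAt I x) (continuousAt_extChartAt x)).congr ?_
  filter_upwards [extChartAt_source_mem_nhds (I := I) x] with z hz
  exact (pointwiseMoment_eq_chart g k hz).symm

variable {F : Type*} [NormedAddCommGroup F] [NormedSpace ℝ F] [FiniteDimensional ℝ F]
  {H' : Type*} [TopologicalSpace H'] {J : ModelWithCorners ℝ F H'} [J.Boundaryless]
  {N : Type*} [TopologicalSpace N] [ChartedSpace H' N] [IsManifold J ∞ N]

omit [FiniteDimensional ℝ E] [FiniteDimensional ℝ F] in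
lemma chartMetric_prodMetric (g : SmoothRiemannianMetric I M) (h : SmoothRiemannianMetric J N)
    (p : M × N) {y : E × F} (hy : y ∈ (extChartAt (I.prod J) p).target) :
    chartMetric (prodMetric g h) p y =
      prodInner (chartMetric g p.1 y.1) (chartMetric h p.2 y.2) := by
  have hy' : y.1 ∈ (extChartAt I p.1).target ∧ y.2 ∈ (extChartAt J p.2).target := by
    rwa [extChartAt_prod] at hy
  have h1 : ((extChartAt (I.prod J) p).symm : E × F → M × N) =
      Prod.map (extChartAt I p.1).symm (extChartAt J p.2).symm := by
    rw [extChartAt_prod]; rfl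
  have h2 : chartSymmDeriv (I.prod J) p y =
      (chartSymmDeriv I p.1 y.1).prodMap (chartSymmDeriv J p.2 y.2) := by
    have h3 := mfderiv_prodMap (p := y) (mdifferentiableAt_extChartAt_symm hy'.1)
      (mdifferentiableAt_extChartAt_symm hy'.2)
    rw [chartSymmDeriv, h1, modelWithCornersSelf_prod, ← chartedSpaceSelf_prod]
    exact h3
  rw [chartMetric_eq, h2, h1]
  rfl

lemma curvatureTensor_prodMetric (g : SmoothRiemannianMetric I M) (h : SmoothRiemannianMetric J N)
    (p : M) (q : N) (X Y Z : TangentSpace (I.prod J) (p, q)) :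
    curvatureTensor (prodMetric g h) (p, q) X Y Z =
      (curvatureTensor g p X.1 Y.1 Z.1, curvatureTensor h q X.2 Y.2 Z.2) := by
  have h0 : extChartAt (I.prod J) (p, q) (p, q) = (extChartAt I p p, extChartAt J q q) := by
    rw [extChartAt_prod]; rfl
  have ho := extChartAt_target_mem_nhds (I := I.prod J) (p, q)
  rw [h0] at ho
  have key := coordCurvature_prod (z := (extChartAt I p p, extChartAt J q q))
    (G := chartMetric g p) (K := chartMetric h q) (Q := chartMetric (prodMetric g h) (p, q))
    (mem_of_superset (extChartAt_target_mem_nhds p) fun a ha => contDiffAt_chartMetric g ha)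
    (mem_of_superset (extChartAt_target_mem_nhds q) fun a ha => contDiffAt_chartMetric h ha)
    (mem_of_superset ho fun a ha => contDiffAt_chartMetric (prodMetric g h) ha)
    (mem_of_superset (extChartAt_target_mem_nhds p) fun a ha => isInvertible_chartMetric g ha)
    (mem_of_superset (extChartAt_target_mem_nhds q) fun a ha => isInvertible_chartMetric h ha)
    (mem_of_superset ho fun a ha => chartMetric_prodMetric g h (p, q) ha) X Y Z
  rw [← h0] at key
  exact key

lemma pointwiseMoment_prodMetric {m n : ℕ} (hm : Module.finrank ℝ E = m)
    (hn : Module.finrank ℝ F = n) (hm2 : 2 ≤ m) (hn2 : 2 ≤ n)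
    (g : SmoothRiemannianMetric I M) (h : SmoothRiemannianMetric J N) (k : ℕ) (p : M) (q : N) :
    pointwiseMoment (prodMetric g h) k (p, q) =
      ∑ r ∈ Finset.range (k + 1), (k.choose r : ℝ) *
        (fallingFactorial ((m : ℝ) + 2 * r - 2) (2 * r) *
          fallingFactorial ((n : ℝ) + 2 * (k - r : ℕ) - 2) (2 * (k - r)) /
          fallingFactorial ((m : ℝ) + n + 2 * k - 2) (2 * k)) *
        (pointwiseMoment g r p * pointwiseMoment h (k - r) q) := by
  have hG : (metricForm g p).IsInvertible :=
    isInvertible_of_forall_pos fun _ hv => metricForm_pos g p hv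
  have hK : (metricForm h q).IsInvertible :=
    isInvertible_of_forall_pos fun _ hv => metricForm_pos h q hv
  simp only [pointwiseMoment_eq_coordMoment]
  exact coordMoment_prod hm hn hm2 hn2 hG hK (curvatureTensor_prodMetric g h p q) k

end Charts

/-! ### Gram determinants -/

section Gram

variable {E : Type*} [NormedAddCommGroup E] [NormedSpace ℝ E]
  {ι : Type*} [Fintype ι] [DecidableEq ι]

/-- The Gram determinant `det (G(v_i, v_j))`. -/
def gramDet (G : E →L[ℝ] E →L[ℝ] ℝ) (v : ι → E) : ℝ := (Matrix.of fun i j => G (v i) (v j)).det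

/-- The transformation of Gram determinants, expressed by the determinant of `v` in the
basis `b`. -/
lemma gramDet_eq_sq_mul (G : E →L[ℝ] E →L[ℝ] ℝ) (b : Module.Basis ι ℝ E) (v : ι → E) :
    gramDet G v = b.det v ^ 2 * gramDet G b := by
  have h1 : (Matrix.of fun i j => G (v i) (v j)) =
      (b.toMatrix v).transpose * (Matrix.of fun i j => G (b i) (b j)) * b.toMatrix v := by
    ext i j
    have hv (i : ι) : v i = ∑ k, b.toMatrix v k i • b k := (b.sum_toMatrix_smul_self v i).symm
    rw [Matrix.of_apply, hv i, hv j]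
    simp only [map_sum, map_smul, sum_apply, smul_apply, smul_eq_mul, Matrix.mul_apply,
      Matrix.transpose_apply, Matrix.of_apply, Finset.mul_sum, Finset.sum_mul]
    refine Finset.sum_congr rfl fun k _ => Finset.sum_congr rfl fun l _ => ?_
    ring
  rw [gramDet, h1, Matrix.det_mul, Matrix.det_mul, Matrix.det_transpose, Module.Basis.det_apply,
    gramDet]
  ring

lemma gramDet_reindex {ι' : Type*} [Fintype ι'] [DecidableEq ι'] (G : E →L[ℝ] E →L[ℝ] ℝ)
    (v : ι → E) (e : ι' ≃ ι) : gramDet G (v ∘ e) = gramDet G v :=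
  Matrix.det_submatrix_equiv_self e (Matrix.of fun i j => G (v i) (v j))

lemma gramDet_comp (G : E →L[ℝ] E →L[ℝ] ℝ) (T : E →L[ℝ] E) (b : Module.Basis ι ℝ E) :
    gramDet (G.bilinearComp T T) b = T.det ^ 2 * gramDet G b := by
  have h1 : gramDet (G.bilinearComp T T) b = gramDet G (T ∘ b) := rfl
  have h2 : b.det (T ∘ b) = T.det := by
    have h := b.det_comp_basis b (T : E →ₗ[ℝ] E)
    simpa using h
  rw [h1, gramDet_eq_sq_mul G b, h2]

lemma gramDet_nonneg {G : E →L[ℝ] E →L[ℝ] ℝ} (hs : ∀ u v, G u v = G v u) (hp : ∀ v, 0 ≤ G v v)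
    (v : ι → E) : 0 ≤ gramDet G v := by
  refine Matrix.PosSemidef.det_nonneg (Matrix.PosSemidef.of_dotProduct_mulVec_nonneg ?_ fun x => ?_)
  · ext i j
    simp [hs (v i)]
  · have h := hp (∑ i, x i • v i)
    simp only [map_sum, map_smul, sum_apply, smul_apply, smul_eq_mul] at h
    simp only [dotProduct, Matrix.mulVec, Matrix.of_apply, star_trivial, Finset.mul_sum] at h ⊢
    rw [Finset.sum_comm] at h
    refine h.trans_eq (Finset.sum_congr rfl fun i _ => Finset.sum_congr rfl fun j _ => ?_)
    ring

lemma gramDet_prod {F ι' : Type*} [NormedAddCommGroup F] [NormedSpace ℝ F] [Fintype ι']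
    [DecidableEq ι'] (G : E →L[ℝ] E →L[ℝ] ℝ) (K : F →L[ℝ] F →L[ℝ] ℝ) (b : Module.Basis ι ℝ E)
    (c : Module.Basis ι' ℝ F) : gramDet (prodInner G K) (b.prod c) = gramDet G b * gramDet K c := by
  have h1 : (Matrix.of fun i j => prodInner G K (b.prod c i) (b.prod c j)) =
      Matrix.fromBlocks (Matrix.of fun i j => G (b i) (b j)) 0 0
        (Matrix.of fun i j => K (c i) (c j)) := by
    ext i j
    rcases i with i | i <;> rcases j with j | j <;> simp [prodInner]
  rw [gramDet, h1, Matrix.det_fromBlocks_zero₂₁]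
  rfl

/-- The measure `√(det (G(b_i, b_j))) db` does not depend on the basis `b`. -/
lemma lintegral_sqrt_gramDet_basis [MeasurableSpace E] [BorelSpace E] [FiniteDimensional ℝ E]
    {ι' : Type*} [Fintype ι'] [DecidableEq ι']
    (b : Module.Basis ι ℝ E) (c : Module.Basis ι' ℝ E) (G : E → E →L[ℝ] E →L[ℝ] ℝ) (S : Set E) :
    ∫⁻ y in S, ENNReal.ofReal √(gramDet (G y) b) ∂b.addHaar =
      ∫⁻ y in S, ENNReal.ofReal √(gramDet (G y) c) ∂c.addHaar := by
  let e : ι ≃ ι' := b.indexEquiv c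
  let c' := c.reindex e.symm
  have hc : c.addHaar = c'.addHaar := (c.addHaar_reindex e.symm).symm
  have hg (y) : gramDet (G y) c = gramDet (G y) c' := by
    rw [← gramDet_reindex (G y) c e]
    congr 1
    ext i
    simp [c']
  have h1 : b.addHaar = ENNReal.ofReal |b.det c'| • c'.addHaar := by
    rw [← Measure.addHaar_parallelepiped, ← Module.Basis.coe_parallelepiped]
    have h := Measure.addHaarMeasure_unique b.addHaar c'.parallelepiped
    rwa [← Module.Basis.addHaar_def] at h
  have h2 (y) : ENNReal.ofReal √(gramDet (G y) c') =
      ENNReal.ofReal |b.det c'| * ENNReal.ofReal √(gramDet (G y) b) := by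
    rw [gramDet_eq_sq_mul (G y) b c', Real.sqrt_mul (sq_nonneg _), Real.sqrt_sq_eq_abs,
      ENNReal.ofReal_mul (abs_nonneg _)]
  simp only [hc, hg, h2]
  rw [lintegral_const_mul' _ _ ENNReal.ofReal_ne_top, h1, Measure.restrict_smul,
    lintegral_smul_measure, smul_eq_mul]

end Gram

/-! ### Gluing of measures -/

section Gluing

/-- Measures `ν i` living on sets `U i` and agreeing on the overlaps glue to their supremum,
provided countably many of the `U i` cover the space. The supremum is bounded above by the measure glued
along a disjoint refinement of a countable cover. -/
lemma iSup_measure_apply_of_compatible {α ι : Type*} [MeasurableSpace α] {U : ι → Set α}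
    (hU : ∀ i, MeasurableSet (U i)) {ν : ι → Measure α} (hν : ∀ i, ν i (U i)ᶜ = 0)
    (hc : ∀ i j A, MeasurableSet A → A ⊆ U i → A ⊆ U j → ν i A = ν j A)
    {s : Set ι} (hs : s.Countable) (hsU : ⋃ i ∈ s, U i = univ) {j : ι} {A : Set α}
    (hA : MeasurableSet A) (hAj : A ⊆ U j) : (⨆ i, ν i) A = ν j A := by
  refine le_antisymm ?_ (le_iSup ν j A)
  rcases s.eq_empty_or_nonempty with rfl | hne
  · have h1 : A = ∅ := by
      refine subset_empty_iff.1 ?_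
      simp only [mem_empty_iff_false, iUnion_of_empty, iUnion_empty] at hsU
      rw [hsU]
      exact subset_univ A
    simp [h1]
  obtain ⟨c, rfl⟩ := hs.exists_eq_range hne
  have hcov : ⋃ n, U (c n) = univ := by simpa using hsU
  let D : ℕ → Set α := disjointed fun n => U (c n)
  have hDm (n) : MeasurableSet (D n) := MeasurableSet.disjointed (fun n => hU (c n)) n
  have hDs (n) : D n ⊆ U (c n) := disjointed_subset _ n
  have hDd : Pairwise (Function.onFun Disjoint D) := disjoint_disjointed _
  have hDu : ⋃ n, D n = univ := by rw [← hcov]; exact iUnion_disjointed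
  let μ : Measure α := Measure.sum fun n => (ν (c n)).restrict (D n)
  have key (i : ι) {B : Set α} (hB : MeasurableSet B) (hBi : B ⊆ U i) : μ B = ν i B := by
    have h1 : B = ⋃ n, B ∩ D n := by rw [← inter_iUnion, hDu, inter_univ]
    rw [Measure.sum_apply _ hB]
    conv_rhs => rw [h1, measure_iUnion (fun m n hmn => (hDd hmn).mono inter_subset_right
      inter_subset_right) fun n => hB.inter (hDm n)]
    refine tsum_congr fun n => ?_
    rw [Measure.restrict_apply hB]
    exact hc _ _ _ (hB.inter (hDm n)) (inter_subset_right.trans (hDs n))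
      (inter_subset_left.trans hBi)
  have hle : ⨆ i, ν i ≤ μ := by
    refine iSup_le fun i => Measure.le_iff.2 fun B hB => ?_
    have h0 : ν i (B \ U i) = 0 := measure_mono_null (fun x hx => hx.2) (hν i)
    calc ν i B ≤ ν i (B ∩ U i) + ν i (B \ U i) := measure_le_inter_add_sdiff _ _ _
      _ = ν i (B ∩ U i) := by rw [h0, add_zero]
      _ = μ (B ∩ U i) := (key i (hB.inter (hU i)) inter_subset_right).symm
      _ ≤ μ B := measure_mono inter_subset_left
  exact (hle A).trans_eq (key j hA hAj)

end Gluing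

/-! ### The Riemannian volume -/

section Volume
open Filter Topology

lemma ContinuousOn.measurableSet_inter_preimage {α β : Type*} [TopologicalSpace α]
    [MeasurableSpace α] [OpensMeasurableSpace α] [TopologicalSpace β] [MeasurableSpace β]
    [BorelSpace β] {f : α → β} {s : Set α} (hf : ContinuousOn f s) (hs : MeasurableSet s)
    {A : Set β} (hA : MeasurableSet A) : MeasurableSet (s ∩ f ⁻¹' A) := by
  have h1 := (continuousOn_iff_continuous_domRestrict.1 hf).measurable hA
  have h2 := hs.subtype_image h1
  convert h2 using 1
  ext x
  simp [and_comm]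

variable {E : Type*} [NormedAddCommGroup E] [NormedSpace ℝ E] [FiniteDimensional ℝ E]
  [MeasurableSpace E] [BorelSpace E]
  {H : Type*} [TopologicalSpace H] {I : ModelWithCorners ℝ E H} [I.Boundaryless]
  {M : Type*} [TopologicalSpace M] [ChartedSpace H M] [IsManifold I ∞ M]
  [MeasurableSpace M] [BorelSpace M]

omit [FiniteDimensional ℝ E] [IsManifold I ∞ M] in
lemma measurableSet_chartImage (x : M) {A : Set M} (hA : MeasurableSet A) :
    MeasurableSet ((extChartAt I x).target ∩ (extChartAt I x).symm ⁻¹' A) :=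
  (continuousOn_extChartAt_symm x).measurableSet_inter_preimage
    (isOpen_extChartAt_target x).measurableSet hA

lemma chartVolume_apply {ι : Type*} [Fintype ι] [DecidableEq ι] (b : Module.Basis ι ℝ E)
    (g : SmoothRiemannianMetric I M) (x : M) {A : Set M} (hA : MeasurableSet A) :
    chartVolume g x A = ∫⁻ y in (extChartAt I x).target ∩ (extChartAt I x).symm ⁻¹' A,
      ENNReal.ofReal √(gramDet (chartMetric g x y) b) ∂b.addHaar := by
  have ht := (isOpen_extChartAt_target (I := I) x).measurableSet
  rw [← lintegral_sqrt_gramDet_basis (Module.finBasis ℝ E) b, chartVolume,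
    Measure.map_apply_of_aemeasurable _ hA, withDensity_apply', Measure.restrict_restrict' ht,
    inter_comm]
  · rfl
  · exact ((continuousOn_extChartAt_symm x).aemeasurable ht).mono_ac
      (withDensity_absolutelyContinuous _ _)

lemma chartVolume_compl_source (g : SmoothRiemannianMetric I M) (x : M) :
    chartVolume g x (extChartAt I x).sourceᶜ = 0 := by
  rw [chartVolume_apply (Module.finBasis ℝ E) g x
    (isOpen_extChartAt_source x).measurableSet.compl]
  have h1 : (extChartAt I x).target ∩ (extChartAt I x).symm ⁻¹' (extChartAt I x).sourceᶜ = ∅ :=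
    eq_empty_of_forall_notMem fun y hy => hy.2 ((extChartAt I x).map_target hy.1)
  rw [h1, Measure.restrict_empty, lintegral_zero_measure]

/-- The volumes of two charts agree on the overlap, by the change of variables formula. -/
lemma chartVolume_eq_of_subset (g : SmoothRiemannianMetric I M) (x x' : M) {A : Set M}
    (hA : MeasurableSet A) (hx : A ⊆ (extChartAt I x).source) (hx' : A ⊆ (extChartAt I x').source) :
    chartVolume g x A = chartVolume g x' A := by
  let b := Module.finBasis ℝ E
  set S := (extChartAt I x).target ∩ (extChartAt I x).symm ⁻¹' A
  have hS : S ⊆ chartOverlap I x x' := fun y hy => ⟨hy.1, hx' hy.2⟩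
  have himage : (extChartAt I x').target ∩ (extChartAt I x').symm ⁻¹' A =
      chartTransition I x x' '' S := by
    ext y
    constructor
    · intro hy
      have hy' : y ∈ chartOverlap I x' x := ⟨hy.1, hx hy.2⟩
      refine ⟨chartTransition I x' x y, ⟨(chartTransition_mem hy').1, ?_⟩,
        chartTransition_chartTransition hy'⟩
      rw [mem_preimage, extChartAt_symm_chartTransition hy']
      exact hy.2
    · rintro ⟨y, hy, rfl⟩
      refine ⟨(chartTransition_mem (hS hy)).1, ?_⟩
      rw [mem_preimage, extChartAt_symm_chartTransition (hS hy)]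
      exact hy.2
  have hinj : InjOn (chartTransition I x x') S := fun y hy z hz h => by
    rw [← chartTransition_chartTransition (hS hy), h, chartTransition_chartTransition (hS hz)]
  have hSm : MeasurableSet S := measurableSet_chartImage x hA
  rw [chartVolume_apply b g x hA, chartVolume_apply b g x' hA, himage,
    lintegral_image_eq_lintegral_abs_det_fderiv_mul _ hSm (fun y hy =>
      ((contDiffAt_chartTransition (hS hy)).differentiableAt
        (by simp)).hasFDerivAt.hasFDerivWithinAt) hinj]
  refine setLIntegral_congr_fun hSm fun y hy => ?_
  rw [chartMetric_eq_pullback g (hS hy), gramDet_comp, Real.sqrt_mul (sq_nonneg _),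
    Real.sqrt_sq_eq_abs, ENNReal.ofReal_mul (abs_nonneg _)]

/-- The Riemannian volume restricts to the volume of each chart. -/
lemma riemannianVolume_apply_of_subset [SecondCountableTopology M]
    (g : SmoothRiemannianMetric I M) {x : M} {A : Set M}
    (hA : MeasurableSet A) (hx : A ⊆ (extChartAt I x).source) :
    riemannianVolume g A = chartVolume g x A := by
  obtain ⟨s, hs, hsU⟩ := TopologicalSpace.countable_cover_nhds
    fun x : M => extChartAt_source_mem_nhds (I := I) x
  exact iSup_measure_apply_of_compatible
    (fun x => (isOpen_extChartAt_source (I := I) x).measurableSet) (chartVolume_compl_source g)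
    (fun x x' A hA hx hx' => chartVolume_eq_of_subset g x x' hA hx hx') hs hsU hA hx

omit [MeasurableSpace E] [BorelSpace E] [FiniteDimensional ℝ E]
  [MeasurableSpace M] [BorelSpace M] in
lemma continuousOn_sqrt_gramDet_chartMetric {ι : Type*} [Fintype ι] [DecidableEq ι]
    (b : Module.Basis ι ℝ E) (g : SmoothRiemannianMetric I M) (x : M) :
    ContinuousOn (fun y => √(gramDet (chartMetric g x y) b)) (extChartAt I x).target := by
  intro y hy
  have h := (contDiffAt_chartMetric g hy).continuousAt
  have h1 : ContinuousAt (fun y => gramDet (chartMetric g x y) b) y := by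
    refine (Continuous.matrix_det (continuous_id)).continuousAt.comp
      (f := fun y => Matrix.of fun i j => chartMetric g x y (b i) (b j)) ?_
    refine continuousAt_pi.2 fun i => continuousAt_pi.2 fun j => ?_
    exact (h.clm_apply continuousAt_const).clm_apply continuousAt_const
  exact (Real.continuous_sqrt.continuousAt.comp h1).continuousWithinAt

lemma isLocallyFiniteMeasure_riemannianVolume [SecondCountableTopology M]
    (g : SmoothRiemannianMetric I M) : IsLocallyFiniteMeasure (riemannianVolume g) := by
  refine ⟨fun x => ?_⟩
  have : ProperSpace E := FiniteDimensional.proper_real E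
  let b := Module.finBasis ℝ E
  obtain ⟨K, ⟨hK, hKc⟩, hKt⟩ := (compact_basis_nhds (extChartAt I x x)).mem_iff.1
    (extChartAt_target_mem_nhds (I := I) x)
  have hW := (continuousOn_extChartAt (I := I) x).measurableSet_inter_preimage
    (isOpen_extChartAt_source x).measurableSet hKc.measurableSet
  refine ⟨(extChartAt I x).source ∩ extChartAt I x ⁻¹' K,
    inter_mem (extChartAt_source_mem_nhds x) ((continuousAt_extChartAt x) hK), ?_⟩
  rw [riemannianVolume_apply_of_subset g hW inter_subset_left, chartVolume_apply b g x hW]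
  have h1 : (extChartAt I x).target ∩ (extChartAt I x).symm ⁻¹'
      ((extChartAt I x).source ∩ extChartAt I x ⁻¹' K) ⊆ K := by
    rintro y ⟨hy, -, hy'⟩
    rwa [mem_preimage, (extChartAt I x).right_inv hy] at hy'
  have h2 : IntegrableOn (fun y => √(gramDet (chartMetric g x y) b)) K b.addHaar :=
    ((continuousOn_sqrt_gramDet_chartMetric b g x).mono hKt).integrableOn_compact hKc
  exact (lintegral_mono_set h1).trans_lt h2.lintegral_lt_top

variable {F : Type*} [NormedAddCommGroup F] [NormedSpace ℝ F] [FiniteDimensional ℝ F]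
  [MeasurableSpace F] [BorelSpace F]
  {H' : Type*} [TopologicalSpace H'] {J : ModelWithCorners ℝ F H'} [J.Boundaryless]
  {N : Type*} [TopologicalSpace N] [ChartedSpace H' N] [IsManifold J ∞ N]
  [MeasurableSpace N] [BorelSpace N]

/-- The density `√(det g_{ij})` of a product metric is the product of the densities of the
factors. -/
lemma chartVolume_prodMetric [SecondCountableTopology M] [SecondCountableTopology N]
    (g : SmoothRiemannianMetric I M) (h : SmoothRiemannianMetric J N) (p : M) (q : N)
    {A : Set M} {B : Set N} (hA : MeasurableSet A) (hB : MeasurableSet B) :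
    chartVolume (prodMetric g h) (p, q) (A ×ˢ B) = chartVolume g p A * chartVolume h q B := by
  let b := Module.finBasis ℝ E
  let c := Module.finBasis ℝ F
  let S := (extChartAt I p).target ∩ (extChartAt I p).symm ⁻¹' A
  let T := (extChartAt J q).target ∩ (extChartAt J q).symm ⁻¹' B
  have hS : MeasurableSet S := measurableSet_chartImage p hA
  have hT : MeasurableSet T := measurableSet_chartImage q hB
  have h1 : (extChartAt (I.prod J) (p, q)).target ∩
      (extChartAt (I.prod J) (p, q)).symm ⁻¹' (A ×ˢ B) = S ×ˢ T := by
    rw [extChartAt_prod]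
    ext y
    simp only [PartialEquiv.prod_target, PartialEquiv.prod_symm, PartialEquiv.prod_coe, S, T,
      mem_inter_iff, mem_prod, mem_preimage]
    tauto
  have h2 : EqOn (fun y => ENNReal.ofReal √(gramDet (chartMetric (prodMetric g h) (p, q) y)
        (b.prod c))) (fun y => ENNReal.ofReal √(gramDet (chartMetric g p y.1) b) *
        ENNReal.ofReal √(gramDet (chartMetric h q y.2) c)) (S ×ˢ T) := by
    intro y hy
    have hy' : y ∈ (extChartAt (I.prod J) (p, q)).target := by
      rw [extChartAt_prod]
      exact ⟨hy.1.1, hy.2.1⟩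
    have hpos (v : E) : 0 ≤ chartMetric g p y.1 v v := by
      rcases eq_or_ne v 0 with rfl | hv
      · simp
      · exact (chartMetric_pos g hy.1.1 hv).le
    simp only
    rw [chartMetric_prodMetric g h (p, q) hy', gramDet_prod,
      Real.sqrt_mul (gramDet_nonneg (chartMetric_symm g p y.1) hpos _),
      ENNReal.ofReal_mul (Real.sqrt_nonneg _)]
  rw [chartVolume_apply (b.prod c) _ _ (hA.prod hB), h1, setLIntegral_congr_fun (hS.prod hT) h2,
    Module.Basis.prod_addHaar, ← Measure.prod_restrict,
    lintegral_prod_mul (f := fun y => ENNReal.ofReal √(gramDet (chartMetric g p y) b))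
      (g := fun y => ENNReal.ofReal √(gramDet (chartMetric h q y) c)),
    ← chartVolume_apply b g p hA, ← chartVolume_apply c h q hB]
  · exact (((continuousOn_sqrt_gramDet_chartMetric b g p).mono inter_subset_left).aemeasurable
      hS).ennreal_ofReal
  · exact (((continuousOn_sqrt_gramDet_chartMetric c h q).mono inter_subset_left).aemeasurable
      hT).ennreal_ofReal

/-- Both measures agree on measurable rectangles in products of chart domains, countably many of
which cover `M × N`. -/
lemma riemannianVolume_prodMetric [SecondCountableTopology M] [SecondCountableTopology N]
    (g : SmoothRiemannianMetric I M) (h : SmoothRiemannianMetric J N)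
    [IsFiniteMeasure (riemannianVolume g)] [IsFiniteMeasure (riemannianVolume h)] :
    riemannianVolume (prodMetric g h) = (riemannianVolume g).prod (riemannianVolume h) := by
  obtain ⟨s, hs, hsU⟩ := TopologicalSpace.countable_cover_nhds
    fun x : M × N => extChartAt_source_mem_nhds (I := I.prod J) x
  have : Countable s := hs
  refine (Measure.ext_iff_of_iUnion_eq_univ (s := fun x : s =>
    (extChartAt (I.prod J) x.1).source) (by simpa [iUnion_subtype] using hsU)).2
    fun ⟨⟨p, q⟩, _⟩ => ?_
  have h1 : (extChartAt (I.prod J) (p, q)).source =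
      (extChartAt I p).source ×ˢ (extChartAt J q).source := by
    rw [extChartAt_prod]; rfl
  simp only [h1]
  rw [← Measure.prod_restrict]
  refine (Measure.prod_eq fun A B hA hB => ?_).symm
  have hA' := hA.inter (isOpen_extChartAt_source (I := I) p).measurableSet
  have hB' := hB.inter (isOpen_extChartAt_source (I := J) q).measurableSet
  rw [Measure.restrict_apply (hA.prod hB), Measure.restrict_apply hA, Measure.restrict_apply hB,
    prod_inter_prod, riemannianVolume_apply_of_subset g hA' inter_subset_right,
    riemannianVolume_apply_of_subset h hB' inter_subset_right,
    riemannianVolume_apply_of_subset (prodMetric g h) (x := (p, q)) (hA'.prod hB')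
      (by rw [h1]; exact prod_mono inter_subset_right inter_subset_right),
    chartVolume_prodMetric g h p q hA' hB']

lemma isFiniteMeasure_riemannianVolume [SecondCountableTopology M] [CompactSpace M]
    (g : SmoothRiemannianMetric I M) : IsFiniteMeasure (riemannianVolume g) :=
  have := isLocallyFiniteMeasure_riemannianVolume g
  CompactSpace.isFiniteMeasure

lemma integrable_pointwiseMoment [SecondCountableTopology M] [CompactSpace M]
    (g : SmoothRiemannianMetric I M) (k : ℕ) :
    Integrable (pointwiseMoment g k) (riemannianVolume g) :=
  have := isFiniteMeasure_riemannianVolume g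
  (continuous_pointwiseMoment g k).integrable_of_hasCompactSupport (.of_compactSpace _)

lemma integratedMoment_prodMetric {m n : ℕ} (hm : Module.finrank ℝ E = m)
    (hn : Module.finrank ℝ F = n) (hm2 : 2 ≤ m) (hn2 : 2 ≤ n)
    [SecondCountableTopology M] [SecondCountableTopology N] [CompactSpace M] [CompactSpace N]
    (g : SmoothRiemannianMetric I M) (h : SmoothRiemannianMetric J N) (k : ℕ) :
    integratedMoment (prodMetric g h) k =
      ∑ r ∈ Finset.range (k + 1), (k.choose r : ℝ) *
        (fallingFactorial ((m : ℝ) + 2 * r - 2) (2 * r) *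
          fallingFactorial ((n : ℝ) + 2 * (k - r : ℕ) - 2) (2 * (k - r)) /
          fallingFactorial ((m : ℝ) + n + 2 * k - 2) (2 * k)) *
        (integratedMoment g r * integratedMoment h (k - r)) := by
  have := isFiniteMeasure_riemannianVolume g
  have := isFiniteMeasure_riemannianVolume h
  have h1 : pointwiseMoment (prodMetric g h) k = fun z => ∑ r ∈ Finset.range (k + 1),
      (k.choose r : ℝ) *
        (fallingFactorial ((m : ℝ) + 2 * r - 2) (2 * r) *
          fallingFactorial ((n : ℝ) + 2 * (k - r : ℕ) - 2) (2 * (k - r)) /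
          fallingFactorial ((m : ℝ) + n + 2 * k - 2) (2 * k)) *
        (pointwiseMoment g r z.1 * pointwiseMoment h (k - r) z.2) :=
    funext fun z => pointwiseMoment_prodMetric hm hn hm2 hn2 g h k z.1 z.2
  simp only [integratedMoment, average_eq]
  rw [riemannianVolume_prodMetric, h1, integral_finsetSum _ fun r _ =>
    ((integrable_pointwiseMoment g r).mul_prod (integrable_pointwiseMoment h (k - r))).const_mul _,
    ← univ_prod_univ, measureReal_prod_prod, Finset.smul_sum]
  refine Finset.sum_congr rfl fun r _ => ?_
  rw [integral_const_mul, integral_prod_mul, mul_inv]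
  simp only [smul_eq_mul]
  ring

end Volume

end

theorem lemma4p1
    {E : Type*} [NormedAddCommGroup E] [NormedSpace ℝ E] [FiniteDimensional ℝ E]
    [MeasurableSpace E] [BorelSpace E]
    {H : Type*} [TopologicalSpace H] (I : ModelWithCorners ℝ E H) [I.Boundaryless]
    {M : Type*} [TopologicalSpace M] [ChartedSpace H M] [IsManifold I ∞ M]
    [T2Space M] [SecondCountableTopology M] [MeasurableSpace M] [BorelSpace M]
    {F : Type*} [NormedAddCommGroup F] [NormedSpace ℝ F] [FiniteDimensional ℝ F]
    [MeasurableSpace F] [BorelSpace F]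
    {H' : Type*} [TopologicalSpace H'] (J : ModelWithCorners ℝ F H') [J.Boundaryless]
    {N : Type*} [TopologicalSpace N] [ChartedSpace H' N] [IsManifold J ∞ N]
    [T2Space N] [SecondCountableTopology N] [MeasurableSpace N] [BorelSpace N]
    (m n : ℕ) (hm : Module.finrank ℝ E = m) (hn : Module.finrank ℝ F = n)
    (hm2 : 2 ≤ m) (hn2 : 2 ≤ n)
    (g : SmoothRiemannianMetric I M) (h : SmoothRiemannianMetric J N) :
    (∀ (p : M) (q : N) (X Y Z : TangentSpace (I.prod J) (p, q)),
      curvatureTensor (prodMetric g h) (p, q) X Y Z =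
        (curvatureTensor g p X.1 Y.1 Z.1, curvatureTensor h q X.2 Y.2 Z.2)) ∧
    (∀ (k : ℕ) (p : M) (q : N),
      pointwiseMoment (prodMetric g h) k (p, q) =
        ∑ r ∈ Finset.range (k + 1), (k.choose r : ℝ) *
          (fallingFactorial ((m : ℝ) + 2 * r - 2) (2 * r) *
            fallingFactorial ((n : ℝ) + 2 * (k - r : ℕ) - 2) (2 * (k - r)) /
            fallingFactorial ((m : ℝ) + n + 2 * k - 2) (2 * k)) *
          (pointwiseMoment g r p * pointwiseMoment h (k - r) q)) ∧
    (CompactSpace M → CompactSpace N → ∀ k : ℕ,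
      Integrable (pointwiseMoment g k) (riemannianVolume g) ∧
      Integrable (pointwiseMoment h k) (riemannianVolume h) ∧
      Integrable (pointwiseMoment (prodMetric g h) k) (riemannianVolume (prodMetric g h)) ∧
      integratedMoment (prodMetric g h) k =
        ∑ r ∈ Finset.range (k + 1), (k.choose r : ℝ) *
          (fallingFactorial ((m : ℝ) + 2 * r - 2) (2 * r) *
            fallingFactorial ((n : ℝ) + 2 * (k - r : ℕ) - 2) (2 * (k - r)) /
            fallingFactorial ((m : ℝ) + n + 2 * k - 2) (2 * k)) *
          (integratedMoment g r * integratedMoment h (k - r))) := by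
  refine ⟨fun p q X Y Z => curvatureTensor_prodMetric g h p q X Y Z,
    fun k p q => pointwiseMoment_prodMetric hm hn hm2 hn2 g h k p q, fun _ _ k => ?_⟩
  exact ⟨integrable_pointwiseMoment g k, integrable_pointwiseMoment h k,
    integrable_pointwiseMoment (prodMetric g h) k,
    integratedMoment_prodMetric hm hn hm2 hn2 g h k⟩
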